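/- **Setting.** Let $D=\{1,\dots,d\}$ and let $\Theta$ be a parameter set. For each $\theta\in\Theta$ let $[p_{xy}(\theta)]_{x,y\in D}$ be a stochastic matrix, and let $f(\cdot\,;\varphi_y(\theta)\mid s_0)$, $y\in D$, $s_0\in\mathbb R$, be probability densities with respect to a $\sigma$-finite measure $\mu$ on $\mathbb R$, jointly measurable in $(s,s_0)$. Under $P^\theta$ the pair $Y_n=(X_n,\xi_n)$ is the Markov chain on $D\times\mathbb R$ (a hidden Markov model with hidden chain $X$ and observations $\xi$) that moves from $(x,s_0)$ to $(x',s)$ with density $p_{xx'}(\theta)f(s;\varphi_{x'}(\theta)\mid s_0)$ with respect to counting measure times $\mu$. Write $\|u\|=\sum_i|u_i|$ for $u\in\mathbb R^d$, $S=\{u\in\mathbb R^d:\|u\|=1\}$, and $M\cdot u=Mu/\|Mu\|$ for a matrix $M$ and $u\in S$ (with $M\cdot u=u$ if $Mu=0$). Let $M_n(\theta)$ be the $d\times d$ matrix with $(i,j)$ entry $p_{ji}(\theta)f(\xi_n;\varphi_i(\theta)\mid\xi_{n-1})$. Fix $\theta_0,\theta_1\in\Theta$. The induced chain on $\mathcal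 X=(D\times\mathbb R)\times S\times S$ is $$W_n=(Y_n,u_n^0,u_n^1),\qquad u_{n}^i=M_{n}(\theta_i)\cdot u_{n-1}^i\quad(n\ge1,\ i=0,1).$$ **Bayesian problem.** Let $0<p\le1$, $0\le\beta\le1$, $c>0$ and $\tilde w\in\mathcal X$. The change point $\omega$ has the prior $\mathbb P_{\tilde w}(\omega=0)=\beta$, $\mathbb P_{\tilde w}(\omega=n)=(1-\beta)p(1-p)^{n-1}$ for $n\ge1$. Given $\omega$, $(W_n)$ is the induced chain started at $W_0=\tilde w$, where $Y_n$ is generated from $Y_{n-1}$ by the transition law of $P^{\theta_0}$ if $1\le n<\omega$ and by that of $P^{\theta_1}$ if $n\ge\max(\omega,1)$. Let $\mathcal F_n=\sigma(W_0,\dots,W_n)$. A proper stopping time is an $(\mathcal F_n)$-stopping time that is finite almost surely. The risk of a stopping time $N$ is $$\rho(N)=\mathbb P_{\tilde w}(N<\omega)+c\,\mathbb E_{\tilde w}(N-\omega)^+,$$ and a proper stopping time is a $B(\beta,p,c,\tilde w)$-Bayes rule if its risk equals the infimum of $\rho$ over all proper stopping times. Let $\delta_n=\mathbb P_{\tilde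 w}(\omega\le n\mid\mathcal F_n)$. **Proposition 1.** For all $0<p\le1$ and $c>0$ there is a measurable function $A_p:\mathcal X\to\mathbb R$, which depends neither on $\beta$ nor on $\tilde w$, such that for every $\beta\in[0,1]$ and every $\tilde w\in\mathcal X$ the time $$N_{A,p}=\inf\{n\ge0:\ \delta_n\ge A_p(W_n)\}\qquad(\inf\emptyset=\infty)$$ is a $B(\beta,p,c,\tilde w)$-Bayes rule; in particular it is a proper stopping time. -/

import Mathlib

open MeasureTheory ProbabilityTheory
open scoped ENNReal

noncomputable section

namespace HMMChange

/-- A parametrized hidden Markov model with hidden states `Fin d` and real observations.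
For each parameter `θ`, the hidden chain `X` has transition matrix `trans θ`, and given the hidden
path the observation `ξ (n+1)` has conditional density `f · (φ (X (n+1)) θ) (ξ n)` with respect to
the σ-finite measure `μ`. The expression `f s a s₀` is the density `f(s; a | s₀)`. -/
structure Model (Θ Φ : Type*) (d : ℕ) where
  /-- transition matrix `[p_{xy}(θ)]` of the hidden chain -/
  trans : Θ → Matrix (Fin d) (Fin d) ℝ
  trans_nonneg : ∀ θ x y, 0 ≤ trans θ x y
  trans_sum : ∀ θ x, ∑ y, trans θ x y = 1
  /-- dominating measure of the observations -/
  μ : Measure ℝ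
  sigmaFinite : SigmaFinite μ
  /-- the functions `φ_y` on the parameter space -/
  φ : Fin d → Θ → Φ
  /-- transition density `f(s; a | s₀)` -/
  f : ℝ → Φ → ℝ → ℝ
  f_nonneg : ∀ y θ s s₀, 0 ≤ f s (φ y θ) s₀
  f_measurable : ∀ y θ, Measurable fun z : ℝ × ℝ => f z.1 (φ y θ) z.2
  f_lintegral : ∀ y θ s₀, ∫⁻ s, ENNReal.ofReal (f s (φ y θ) s₀) ∂μ = 1

/-- The vectors of `L¹` norm one in `ℝ^d`, i.e. the set of all normalizations `u / ‖u‖`. -/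
abbrev UnitVec (d : ℕ) : Type := {u : Fin d → ℝ // ∑ i, |u i| = 1}

/-- The state space `D × ℝ` of the pair `Y = (X, ξ)`. -/
abbrev Pair (d : ℕ) : Type := Fin d × ℝ

/-- The state space of the induced chain: the pair `(X, ξ)` and two normalized vectors, the first
one for the pre-change parameter, the second one for the post-change parameter. -/
abbrev State (d : ℕ) : Type := Pair d × UnitVec d × UnitVec d

/-- The normalization `u / ‖u‖` for the `L¹` norm; where it is undefined (`u = 0`) the value is the
given vector `u₀`. -/
def normalizeOr {d : ℕ} (u₀ : UnitVec d) (u : Fin d → ℝ) : UnitVec d :=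
  if h : ∑ i, |u i| = 0 then u₀ else
    ⟨fun i => u i / ∑ j, |u j|, by
      have h0 : 0 ≤ ∑ j, |u j| := Finset.sum_nonneg fun _ _ => abs_nonneg _
      simp_rw [abs_div, abs_of_nonneg h0]
      rw [← Finset.sum_div, div_self h]⟩

/-- The projective action `M · u = M u / ‖M u‖` of a matrix on a normalized vector. If `M` is
invertible then `M u ≠ 0`; if `M u = 0` the vector is left unchanged. -/
def act {d : ℕ} (M : Matrix (Fin d) (Fin d) ℝ) (u : UnitVec d) : UnitVec d :=
  normalizeOr u (M.mulVec u.1)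

lemma measurable_normalizeOr {d : ℕ} :
    Measurable fun z : UnitVec d × (Fin d → ℝ) => normalizeOr z.1 z.2 := by
  have hs : Measurable fun z : UnitVec d × (Fin d → ℝ) => ∑ i, |z.2 i| := by fun_prop
  have hset : MeasurableSet {z : UnitVec d × (Fin d → ℝ) | ∑ i, |z.2 i| = 0} :=
    hs (measurableSet_singleton 0)
  refine Measurable.subtype_mk
    (f := fun z : UnitVec d × (Fin d → ℝ) => (normalizeOr z.1 z.2).1) ?_
    (h := fun z => (normalizeOr z.1 z.2).2)
  have : (fun z : UnitVec d × (Fin d → ℝ) => (normalizeOr z.1 z.2).1) = fun z =>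
      if ∑ i, |z.2 i| = 0 then z.1.1 else fun i => z.2 i / ∑ j, |z.2 j| := by
    funext z
    unfold normalizeOr
    split_ifs <;> rfl
  rw [this]
  exact Measurable.ite hset (by fun_prop) (by fun_prop)

namespace Model

variable {Θ Φ : Type*} {d : ℕ} (H : Model Θ Φ d)

/-- The density of the transition of `(X, ξ)` from `y = (x, s₀)` to `y' = (x', s)`, namely
`p_{x x'}(θ) f(s; φ_{x'}(θ) | s₀)`, with respect to counting measure times `μ`. -/
def pairDensity (θ : Θ) (y y' : Pair d) : ℝ :=
  H.trans θ y.1 y'.1 * H.f y'.2 (H.φ y'.1 θ) y.2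

lemma pairDensity_measurable (θ : Θ) :
    Measurable fun z : Pair d × Pair d => H.pairDensity θ z.1 z.2 := by
  have h : Measurable fun z : (Fin d × Fin d) × (ℝ × ℝ) =>
      H.trans θ z.1.1 z.1.2 * H.f z.2.1 (H.φ z.1.2 θ) z.2.2 :=
    by
    refine measurable_from_prod_countable_right fun a => ?_
    exact (H.f_measurable a.2 θ).const_mul (H.trans θ a.1 a.2)
  exact h.comp (g := fun z => _) (f := fun z : Pair d × Pair d =>
    ((z.1.1, z.2.1), (z.2.2, z.1.2))) (by fun_prop)

/-- The transition kernel of the pair `(X, ξ)` under the parameter `θ`. -/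
def pairKernel (θ : Θ) : Kernel (Pair d) (Pair d) :=
  haveI := H.sigmaFinite
  Kernel.withDensity (Kernel.const _ (Measure.count.prod H.μ))
    fun y y' => ENNReal.ofReal (H.pairDensity θ y y')

instance (θ : Θ) : IsMarkovKernel (H.pairKernel θ) := by
  have := H.sigmaFinite
  refine ⟨fun y => ⟨?_⟩⟩
  have hm : Measurable (Function.uncurry fun y y' => ENNReal.ofReal (H.pairDensity θ y y')) :=
    (H.pairDensity_measurable θ).ennreal_ofReal
  have hy : Measurable fun y' => ENNReal.ofReal (H.pairDensity θ y y') :=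
    hm.comp measurable_prodMk_left
  rw [pairKernel, Kernel.withDensity_apply _ hm, withDensity_apply _ MeasurableSet.univ,
    Measure.restrict_univ, Kernel.const_apply, lintegral_prod _ hy.aemeasurable,
    lintegral_count, tsum_fintype]
  have h1 : ∀ x', ∫⁻ s, ENNReal.ofReal (H.pairDensity θ y (x', s)) ∂H.μ
      = ENNReal.ofReal (H.trans θ y.1 x') := by
    intro x'
    simp only [pairDensity, ENNReal.ofReal_mul (H.trans_nonneg θ y.1 x')]
    rw [lintegral_const_mul' _ _ ENNReal.ofReal_ne_top, H.f_lintegral, mul_one]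
  simp_rw [h1]
  rw [← ENNReal.ofReal_sum_of_nonneg fun i _ => H.trans_nonneg θ y.1 i, H.trans_sum,
    ENNReal.ofReal_one]

/-- The random matrix `M(θ)` of a transition from `y = (x, s₀)` to `y' = (x', s)`: its entry in
row `i` and column `j` is `p_{ji}(θ) f(s; φ_i(θ) | s₀)`. -/
def stepMatrix (θ : Θ) (y y' : Pair d) : Matrix (Fin d) (Fin d) ℝ :=
  Matrix.of fun i j => H.trans θ j i * H.f y'.2 (H.φ i θ) y.2

/-- The update of the induced chain when `(X, ξ)` moves to `y'`. -/
def step (θ₀ θ₁ : Θ) (w : State d) (y' : Pair d) : State d :=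
  (y', act (H.stepMatrix θ₀ w.1 y') w.2.1, act (H.stepMatrix θ₁ w.1 y') w.2.2)

lemma stepMatrix_measurable (θ : Θ) :
    Measurable fun z : (Pair d × Pair d) × UnitVec d =>
      act (H.stepMatrix θ z.1.1 z.1.2) z.2 := by
  refine measurable_normalizeOr.comp (f := fun z : (Pair d × Pair d) × UnitVec d =>
    (z.2, (H.stepMatrix θ z.1.1 z.1.2).mulVec z.2.1)) (measurable_snd.prodMk ?_)
  refine measurable_pi_lambda _ fun i => ?_
  simp only [Matrix.mulVec, dotProduct, stepMatrix, Matrix.of_apply]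
  have hf : Measurable fun z : (Pair d × Pair d) × UnitVec d =>
      H.f z.1.2.2 (H.φ i θ) z.1.1.2 :=
    (H.f_measurable i θ).comp (f := fun z : (Pair d × Pair d) × UnitVec d =>
      (z.1.2.2, z.1.1.2)) (by fun_prop)
  refine Finset.measurable_sum _ fun j _ => ?_
  exact (hf.const_mul _).mul
    ((measurable_pi_apply j).comp (measurable_subtype_coe.comp measurable_snd))

lemma step_measurable (θ₀ θ₁ : Θ) :
    Measurable fun z : State d × Pair d => H.step θ₀ θ₁ z.1 z.2 := by
  refine measurable_snd.prodMk (Measurable.prodMk ?_ ?_)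
  · exact (H.stepMatrix_measurable θ₀).comp
      (f := fun z : State d × Pair d => ((z.1.1, z.2), z.1.2.1)) (by fun_prop)
  · exact (H.stepMatrix_measurable θ₁).comp
      (f := fun z : State d × Pair d => ((z.1.1, z.2), z.1.2.2)) (by fun_prop)

/-- The transition kernel of the induced chain when `(X, ξ)` moves according to the
parameter `θ`. -/
def stateKernel (θ₀ θ₁ θ : Θ) : Kernel (State d) (State d) :=
  Kernel.map (Kernel.id ×ₖ (H.pairKernel θ).comap Prod.fst measurable_fst)
    fun z => H.step θ₀ θ₁ z.1 z.2

instance (θ₀ θ₁ θ : Θ) : IsMarkovKernel (H.stateKernel θ₀ θ₁ θ) :=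
  Kernel.IsMarkovKernel.map _ (H.step_measurable θ₀ θ₁)

/-- The law of the induced chain from time `n` to time `n + 1` when the change happens at
time `k`: the value at time `n + 1` is generated with `θ₁` if and only if `k ≤ n + 1`. -/
def changeKernel (θ₀ θ₁ : Θ) (k n : ℕ) :
    Kernel (Π _ : Finset.Iic n, State d) (State d) :=
  (H.stateKernel θ₀ θ₁ (if k ≤ n + 1 then θ₁ else θ₀)).comap
    (fun path => path ⟨n, Finset.mem_Iic.2 le_rfl⟩) (measurable_pi_apply _)

instance (θ₀ θ₁ : Θ) (k n : ℕ) : IsMarkovKernel (H.changeKernel θ₀ θ₁ k n) :=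
  Kernel.IsMarkovKernel.comap _ (measurable_pi_apply _)

/-- The law of the induced chain `(W_0, W_1, …)` started at `W_0 = w`, with change at time `k`. -/
def pathLaw (θ₀ θ₁ : Θ) (k : ℕ) (w : State d) : Measure (ℕ → State d) :=
  Kernel.traj (X := fun _ => State d) (H.changeKernel θ₀ θ₁ k) 0 fun _ => w

instance (θ₀ θ₁ : Θ) (k : ℕ) (w : State d) : IsProbabilityMeasure (H.pathLaw θ₀ θ₁ k w) := by
  unfold pathLaw; infer_instance

end Model

/-- The prior of the change point: mass `β` at `0` and `(1 - β) p (1 - p)^(n-1)` at `n ≥ 1`. -/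
def priorMass (β p : ℝ) : ℕ → ℝ
  | 0 => β
  | n + 1 => (1 - β) * p * (1 - p) ^ n

/-- The sample space: a change point and a path of the induced chain. -/
abbrev Sample (d : ℕ) : Type := ℕ × (ℕ → State d)

/-- The change point `ω`. -/
def changePoint {d : ℕ} (z : Sample d) : ℕ := z.1

/-- The induced chain `W_n`. -/
def W {d : ℕ} (n : ℕ) (z : Sample d) : State d := z.2 n

lemma measurable_W {d : ℕ} (n : ℕ) : Measurable (W (d := d) n) :=
  (measurable_pi_apply n).comp measurable_snd

/-- The filtration `σ(W_0, …, W_n)`. -/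
def filt (d : ℕ) : Filtration ℕ (inferInstance : MeasurableSpace (Sample d)) where
  seq n := ⨆ j ≤ n, MeasurableSpace.comap (W j) inferInstance
  mono' _ _ h := biSup_mono fun _ hj => hj.trans h
  le' _ := iSup₂_le fun j _ => (measurable_W j).comap_le

namespace Model

variable {Θ Φ : Type*} {d : ℕ} (H : Model Θ Φ d)

/-- The joint law of the change point and the induced chain in the Bayesian problem with prior
parameters `β, p` and initial state `w`. -/
def bayesLaw (θ₀ θ₁ : Θ) (β p : ℝ) (w : State d) : Measure (Sample d) :=
  Measure.sum fun k => ENNReal.ofReal (priorMass β p k) •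
    (H.pathLaw θ₀ θ₁ k w).map fun path => (k, path)

end Model

/-- The detection delay `(N - ω)⁺` for the values `N = n` and `ω = k` (the subtraction of natural
numbers is truncated at `0`); it is infinite for `N = ∞`. -/
def delay (k : ℕ) : WithTop ℕ → ℝ≥0∞ :=
  WithTop.recTopCoe ⊤ fun n => ((n - k : ℕ) : ℝ≥0∞)

/-- The risk `P(N < ω) + c E (N - ω)⁺` of a detection policy. -/
def risk {d : ℕ} (P : Measure (Sample d)) (c : ℝ) (N : Sample d → WithTop ℕ) : ℝ≥0∞ :=
  P {z | N z < (changePoint z : WithTop ℕ)} +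
    ENNReal.ofReal c * ∫⁻ z, delay (changePoint z) (N z) ∂P

/-- A stopping time of the induced chain that is finite almost surely. -/
def IsProperStoppingTime {d : ℕ} (P : Measure (Sample d)) (N : Sample d → WithTop ℕ) : Prop :=
  IsStoppingTime (filt d) N ∧ ∀ᵐ z ∂P, N z ≠ ⊤

/-- A Bayes time: a proper stopping time whose risk is the infimum of the risk over all proper
stopping times. -/
def IsBayesTime {d : ℕ} (P : Measure (Sample d)) (c : ℝ) (N : Sample d → WithTop ℕ) : Prop :=
  IsProperStoppingTime P N ∧
    risk P c N = ⨅ (N' : Sample d → WithTop ℕ) (_ : IsProperStoppingTime P N'), risk P c N'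

/-- The posterior probability `δ_n = P(ω ≤ n | W_0, …, W_n)`. -/
def posterior {d : ℕ} (P : Measure (Sample d)) (n : ℕ) : Sample d → ℝ :=
  P⟦{z | changePoint z ≤ n} | filt d n⟧

/-- The first time `n ≥ 0` with `δ_n ≥ A (W_n)`, and `⊤` if there is none. -/
def thresholdTime {d : ℕ} (P : Measure (Sample d)) (A : State d → ℝ) :
    Sample d → WithTop ℕ :=
  hittingAfter (fun n z => (posterior P n z, W n z)) {x | A x.2 ≤ x.1} 0

end HMMChange

end

/-! The proof is dynamic programming with unnormalized masses. Let `a` and `b` be the masses of the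
events that the change has and has not happened. Given no change so far, the prior makes it happen
in the next step with constant probability `p`. Hence a move from `y` to `y'` turns `(a, b)` into
`((a + p b) f₁(y, y'), (1 - p) b f₀(y, y'))`, where `f₀` and `f₁` are the transition densities of
the pair under `θ₀` and `θ₁`. Stopping costs `b`, and one more step costs `c a`. Let `value a b w`
be the limit of the finite-horizon values. It involves neither `β` nor the initial state, is
monotone in `a` and `b`, is homogeneous of degree one, and solves the optimality equation
`value_eq`.

Homogeneity and monotonicity show that the `t` in `[0, 1]` for which stopping is optimal at `(t, 1 -
t, w)` form an up-set (`mem_stoppingSet_of_le`). Lipschitz bounds in `a`, one for each horizon, show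
that the infimum of this set belongs to it (`threshold_mem_stoppingSet`). This infimum is the
threshold `A_p(w)`, so "`δ_n` is at least the threshold" means exactly "stopping now is optimal".

To return to the Bayesian problem, the posterior is identified with a recursion on histories
(`hasPosterior`, `posterior_ae_eq`). By homogeneity its normalization drops out of the expected next
value (`setLIntegral_value_succ`). The risk is a sum of contributions of single times
(`risk_eq_tsum`), and the optimality equation telescopes against it. For every stopping time the
initial value is at most the risk, because the remainder at time `n` is bounded by `P(ω > n) = (1 -
β)(1 - p)^n`, which tends to `0`. For the threshold time each step of the telescoping is an
equality, so it attains the bound. Its risk is then finite, which forces it to be finite almost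
surely. -/

noncomputable section

namespace HMMChange

/-! ### Dynamic programming: the value function of the stopping problem -/

namespace Model

variable {Θ Φ : Type*} {d : ℕ} (H : Model Θ Φ d)

/-- The reference measure of the transition densities of the pair `(X, ξ)`. -/
def refMeasure : Measure (Pair d) := Measure.count.prod H.μ

instance : SFinite H.refMeasure := by
  have := H.sigmaFinite
  unfold refMeasure
  infer_instance

/-- The transition density of the pair `(X, ξ)` as an extended nonnegative real. -/
def density (θ : Θ) (y y' : Pair d) : ℝ≥0∞ := ENNReal.ofReal (H.pairDensity θ y y')

lemma measurable_density (θ : Θ) :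
    Measurable fun z : Pair d × Pair d => H.density θ z.1 z.2 :=
  (H.pairDensity_measurable θ).ennreal_ofReal

@[fun_prop]
lemma measurable_density_comp {α : Type*} [MeasurableSpace α] (θ : Θ) {f g : α → Pair d}
    (hf : Measurable f) (hg : Measurable g) : Measurable fun x => H.density θ (f x) (g x) :=
  (H.measurable_density θ).comp (hf.prodMk hg)

@[fun_prop]
lemma measurable_step_comp {α : Type*} [MeasurableSpace α] (θ₀ θ₁ : Θ) {f : α → State d}
    {g : α → Pair d} (hf : Measurable f) (hg : Measurable g) :
    Measurable fun x => H.step θ₀ θ₁ (f x) (g x) :=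
  (H.step_measurable θ₀ θ₁).comp (hf.prodMk hg)

lemma pairKernel_apply (θ : Θ) (y : Pair d) :
    H.pairKernel θ y = H.refMeasure.withDensity (H.density θ y) := by
  have := H.sigmaFinite
  rw [pairKernel, Kernel.withDensity_apply _ (H.measurable_density θ)]
  rfl

lemma lintegral_density (θ : Θ) (y : Pair d) : ∫⁻ y', H.density θ y y' ∂H.refMeasure = 1 := by
  have h := measure_univ (μ := H.pairKernel θ y)
  rwa [H.pairKernel_apply, withDensity_apply _ .univ, Measure.restrict_univ] at h

lemma lintegral_stateKernel (θ₀ θ₁ θ : Θ) (w : State d) {g : State d → ℝ≥0∞}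
    (hg : Measurable g) :
    ∫⁻ s, g s ∂H.stateKernel θ₀ θ₁ θ w =
      ∫⁻ y', H.density θ w.1 y' * g (H.step θ₀ θ₁ w y') ∂H.refMeasure := by
  rw [stateKernel, Kernel.lintegral_map _ (H.step_measurable θ₀ θ₁) _ hg,
    Kernel.lintegral_id_prod (by fun_prop), Kernel.comap_apply, H.pairKernel_apply,
    lintegral_withDensity_eq_lintegral_mul _ (by fun_prop) (by fun_prop)]
  rfl

variable (θ₀ θ₁ : Θ) (p c : ℝ)

/-- The mass of the event that the change has happened after a transition from `y` to `y'`, when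
before it the masses of the event and its complement are `a` and `b`. -/
def changedMass (a b : ℝ≥0∞) (y y' : Pair d) : ℝ≥0∞ :=
  (a + ENNReal.ofReal p * b) * H.density θ₁ y y'

/-- The mass of the event that the change has not yet happened after a transition from `y`
to `y'`, when before it this event has mass `b`. -/
def unchangedMass (b : ℝ≥0∞) (y y' : Pair d) : ℝ≥0∞ :=
  ENNReal.ofReal (1 - p) * b * H.density θ₀ y y'

@[fun_prop]
lemma measurable_changedMass_comp {α : Type*} [MeasurableSpace α] {a b : α → ℝ≥0∞}
    {f g : α → Pair d} (ha : Measurable a) (hb : Measurable b) (hf : Measurable f)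
    (hg : Measurable g) : Measurable fun x => H.changedMass θ₁ p (a x) (b x) (f x) (g x) := by
  unfold changedMass; fun_prop

@[fun_prop]
lemma measurable_unchangedMass_comp {α : Type*} [MeasurableSpace α] {b : α → ℝ≥0∞}
    {f g : α → Pair d} (hb : Measurable b) (hf : Measurable f)
    (hg : Measurable g) : Measurable fun x => H.unchangedMass θ₀ p (b x) (f x) (g x) := by
  unfold unchangedMass; fun_prop

lemma lintegral_unchangedMass (b : ℝ≥0∞) (y : Pair d) :
    ∫⁻ y', H.unchangedMass θ₀ p b y y' ∂H.refMeasure = ENNReal.ofReal (1 - p) * b := by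
  unfold unchangedMass
  rw [lintegral_const_mul _ (by fun_prop), H.lintegral_density, mul_one]

/-- The risk of continuing, when the later risk is `v`. -/
def continuationRisk (v : ℝ≥0∞ → ℝ≥0∞ → State d → ℝ≥0∞) (a b : ℝ≥0∞) (w : State d) : ℝ≥0∞ :=
  ENNReal.ofReal c * a + ∫⁻ y', v (H.changedMass θ₁ p a b w.1 y')
    (H.unchangedMass θ₀ p b w.1 y') (H.step θ₀ θ₁ w y') ∂H.refMeasure

/-- The least risk over stopping rules with horizon `k`, for the masses `a` and `b` of the events
that the change has and has not happened. -/
def finiteValue : ℕ → ℝ≥0∞ → ℝ≥0∞ → State d → ℝ≥0∞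
  | 0 => fun _ b _ => b
  | k + 1 => fun a b w => min b (H.continuationRisk θ₀ θ₁ p c (finiteValue k) a b w)

/-- The least risk over all stopping rules. -/
def value (a b : ℝ≥0∞) (w : State d) : ℝ≥0∞ := ⨅ k, H.finiteValue θ₀ θ₁ p c k a b w

lemma measurable_continuationRisk {v : ℝ≥0∞ → ℝ≥0∞ → State d → ℝ≥0∞}
    (hv : Measurable fun z : ℝ≥0∞ × ℝ≥0∞ × State d => v z.1 z.2.1 z.2.2) :
    Measurable fun z : ℝ≥0∞ × ℝ≥0∞ × State d =>
      H.continuationRisk θ₀ θ₁ p c v z.1 z.2.1 z.2.2 := by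
  unfold continuationRisk
  refine Measurable.add (by fun_prop) (Measurable.lintegral_prod_right' (f := fun q :
    (ℝ≥0∞ × ℝ≥0∞ × State d) × Pair d => v (H.changedMass θ₁ p q.1.1 q.1.2.1 q.1.2.2.1 q.2)
    (H.unchangedMass θ₀ p q.1.2.1 q.1.2.2.1 q.2) (H.step θ₀ θ₁ q.1.2.2 q.2)) ?_)
  exact hv.comp (f := fun q : (ℝ≥0∞ × ℝ≥0∞ × State d) × Pair d =>
    (H.changedMass θ₁ p q.1.1 q.1.2.1 q.1.2.2.1 q.2,
      H.unchangedMass θ₀ p q.1.2.1 q.1.2.2.1 q.2, H.step θ₀ θ₁ q.1.2.2 q.2)) (by fun_prop)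

lemma measurable_finiteValue (k : ℕ) :
    Measurable fun z : ℝ≥0∞ × ℝ≥0∞ × State d =>
      H.finiteValue θ₀ θ₁ p c k z.1 z.2.1 z.2.2 := by
  induction k with
  | zero => unfold finiteValue; fun_prop
  | succ k ih =>
    unfold finiteValue
    exact Measurable.min (by fun_prop) (H.measurable_continuationRisk θ₀ θ₁ p c ih)

lemma measurable_value :
    Measurable fun z : ℝ≥0∞ × ℝ≥0∞ × State d => H.value θ₀ θ₁ p c z.1 z.2.1 z.2.2 :=
  Measurable.iInf fun k => H.measurable_finiteValue θ₀ θ₁ p c k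

lemma measurable_finiteValue_comp (k : ℕ) {α : Type*} [MeasurableSpace α] {a b : α → ℝ≥0∞}
    {w : α → State d} (ha : Measurable a) (hb : Measurable b) (hw : Measurable w) :
    Measurable fun x => H.finiteValue θ₀ θ₁ p c k (a x) (b x) (w x) :=
  (H.measurable_finiteValue θ₀ θ₁ p c k).comp (ha.prodMk (hb.prodMk hw))

lemma measurable_value_comp {α : Type*} [MeasurableSpace α] {a b : α → ℝ≥0∞}
    {w : α → State d} (ha : Measurable a) (hb : Measurable b) (hw : Measurable w) :
    Measurable fun x => H.value θ₀ θ₁ p c (a x) (b x) (w x) :=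
  (H.measurable_value θ₀ θ₁ p c).comp (ha.prodMk (hb.prodMk hw))

lemma value_le (a b : ℝ≥0∞) (w : State d) : H.value θ₀ θ₁ p c a b w ≤ b :=
  iInf_le_of_le 0 le_rfl

lemma continuationRisk_mono {v v' : ℝ≥0∞ → ℝ≥0∞ → State d → ℝ≥0∞}
    (h : ∀ a b w, v a b w ≤ v' a b w) (a b : ℝ≥0∞) (w : State d) :
    H.continuationRisk θ₀ θ₁ p c v a b w ≤ H.continuationRisk θ₀ θ₁ p c v' a b w := by
  unfold continuationRisk
  gcongr
  exact h _ _ _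

lemma finiteValue_antitone (a b : ℝ≥0∞) (w : State d) :
    Antitone fun k => H.finiteValue θ₀ θ₁ p c k a b w := by
  refine antitone_nat_of_succ_le fun k => ?_
  induction k generalizing a b w with
  | zero => exact min_le_left _ _
  | succ k ih => exact min_le_min_left _ (H.continuationRisk_mono θ₀ θ₁ p c ih a b w)

lemma finiteValue_mono (k : ℕ) {a a' b b' : ℝ≥0∞} (ha : a ≤ a') (hb : b ≤ b') (w : State d) :
    H.finiteValue θ₀ θ₁ p c k a b w ≤ H.finiteValue θ₀ θ₁ p c k a' b' w := by
  induction k generalizing a a' b b' w with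
  | zero => exact hb
  | succ k ih =>
    refine min_le_min hb ?_
    unfold continuationRisk
    gcongr
    apply ih
    · unfold changedMass; gcongr
    · unfold unchangedMass; gcongr

lemma value_mono {a a' b b' : ℝ≥0∞} (ha : a ≤ a') (hb : b ≤ b') (w : State d) :
    H.value θ₀ θ₁ p c a b w ≤ H.value θ₀ θ₁ p c a' b' w :=
  iInf_mono fun k => H.finiteValue_mono θ₀ θ₁ p c k ha hb w

/-- The cost of stopping, the cost of a step and the updates of both masses are linear in `(a, b)`.
This is what makes unnormalized masses interchangeable with posterior probabilities. -/
lemma finiteValue_mul (k : ℕ) {t : ℝ≥0∞} (ht : t ≠ ∞) (a b : ℝ≥0∞) (w : State d) :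
    H.finiteValue θ₀ θ₁ p c k (t * a) (t * b) w = t * H.finiteValue θ₀ θ₁ p c k a b w := by
  induction k generalizing a b w with
  | zero => rfl
  | succ k ih =>
    have h : ∀ y', H.finiteValue θ₀ θ₁ p c k (H.changedMass θ₁ p (t * a) (t * b) w.1 y')
        (H.unchangedMass θ₀ p (t * b) w.1 y') (H.step θ₀ θ₁ w y') =
        t * H.finiteValue θ₀ θ₁ p c k (H.changedMass θ₁ p a b w.1 y')
        (H.unchangedMass θ₀ p b w.1 y') (H.step θ₀ θ₁ w y') := by
      intro y'
      rw [← ih]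
      congr 1
      · unfold changedMass; ring
      · unfold unchangedMass; ring
    unfold finiteValue continuationRisk
    simp only [h]
    rw [lintegral_const_mul' _ _ ht, mul_min, mul_add]
    congr 2
    ring

lemma value_mul {t : ℝ≥0∞} (ht : t ≠ ∞) (a b : ℝ≥0∞) (w : State d) :
    H.value θ₀ θ₁ p c (t * a) (t * b) w = t * H.value θ₀ θ₁ p c a b w := by
  unfold value
  rw [ENNReal.mul_iInf fun h => absurd h ht]
  simp only [H.finiteValue_mul θ₀ θ₁ p c _ ht]

/-- Additional changed mass `e` stays changed, keeps its total mass since the density of `θ₁`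
integrates to one, and pays `c` per unit in each of at most `k` steps. The resulting Lipschitz bound
depends on `k`, which suffices for the closedness of the stopping set. -/
lemma finiteValue_add_le (k : ℕ) (a b e : ℝ≥0∞) (w : State d) :
    H.finiteValue θ₀ θ₁ p c k (a + e) b w ≤
      H.finiteValue θ₀ θ₁ p c k a b w + k * ENNReal.ofReal c * e := by
  induction k generalizing a b e w with
  | zero => simp [finiteValue]
  | succ k ih =>
    have hmeas : Measurable fun y' => H.finiteValue θ₀ θ₁ p c k (H.changedMass θ₁ p a b w.1 y')
        (H.unchangedMass θ₀ p b w.1 y') (H.step θ₀ θ₁ w y') :=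
      H.measurable_finiteValue_comp θ₀ θ₁ p c k (by fun_prop) (by fun_prop) (by fun_prop)
    have h : ∀ y', H.finiteValue θ₀ θ₁ p c k (H.changedMass θ₁ p (a + e) b w.1 y')
        (H.unchangedMass θ₀ p b w.1 y') (H.step θ₀ θ₁ w y') ≤
        H.finiteValue θ₀ θ₁ p c k (H.changedMass θ₁ p a b w.1 y')
        (H.unchangedMass θ₀ p b w.1 y') (H.step θ₀ θ₁ w y') +
        k * ENNReal.ofReal c * e * H.density θ₁ w.1 y' := by
      intro y'
      have h1 : H.changedMass θ₁ p (a + e) b w.1 y' =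
          H.changedMass θ₁ p a b w.1 y' + e * H.density θ₁ w.1 y' := by
        unfold changedMass; ring
      rw [h1, mul_assoc _ e]
      exact ih _ _ _ _
    have h2 : ENNReal.ofReal c * (a + e) + ∫⁻ y', H.finiteValue θ₀ θ₁ p c k
        (H.changedMass θ₁ p (a + e) b w.1 y') (H.unchangedMass θ₀ p b w.1 y')
        (H.step θ₀ θ₁ w y') ∂H.refMeasure ≤
        ENNReal.ofReal c * a + (∫⁻ y', H.finiteValue θ₀ θ₁ p c k
        (H.changedMass θ₁ p a b w.1 y') (H.unchangedMass θ₀ p b w.1 y')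
        (H.step θ₀ θ₁ w y') ∂H.refMeasure) + (k + 1 : ℕ) * ENNReal.ofReal c * e := by
      calc _ ≤ ENNReal.ofReal c * (a + e) + ∫⁻ y', (H.finiteValue θ₀ θ₁ p c k
            (H.changedMass θ₁ p a b w.1 y') (H.unchangedMass θ₀ p b w.1 y')
            (H.step θ₀ θ₁ w y') + k * ENNReal.ofReal c * e * H.density θ₁ w.1 y')
            ∂H.refMeasure := by gcongr; exact h _
        _ = _ := by
          rw [lintegral_add_left hmeas, lintegral_const_mul _ (by fun_prop), H.lintegral_density]
          push_cast
          ring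
    unfold finiteValue continuationRisk
    rw [← min_add_add_right]
    exact min_le_min le_self_add h2

/-- The optimality equation follows from the finite-horizon recursion by monotone convergence for a
decreasing sequence. That theorem needs one finite integral: the horizon-zero value integrates to
`(1 - p) b`, which is where `hb` enters. -/
lemma value_eq {a b : ℝ≥0∞} (hb : b ≠ ∞) (w : State d) :
    H.value θ₀ θ₁ p c a b w =
      min b (H.continuationRisk θ₀ θ₁ p c (H.value θ₀ θ₁ p c) a b w) := by
  have hcont : H.continuationRisk θ₀ θ₁ p c (H.value θ₀ θ₁ p c) a b w =
      ⨅ k, H.continuationRisk θ₀ θ₁ p c (H.finiteValue θ₀ θ₁ p c k) a b w := by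
    unfold continuationRisk value
    rw [lintegral_iInf, ENNReal.add_iInf]
    · exact fun k => H.measurable_finiteValue_comp θ₀ θ₁ p c k (by fun_prop) (by fun_prop)
        (by fun_prop)
    · exact fun k l hkl y' => H.finiteValue_antitone θ₀ θ₁ p c _ _ _ hkl
    · simp only [finiteValue]
      rw [H.lintegral_unchangedMass]
      exact ENNReal.mul_ne_top ENNReal.ofReal_ne_top hb
  rw [hcont, inf_iInf]
  -- The right-hand side is now the infimum over the horizons `k + 1`; antitonicity in the horizon
  -- makes the shift irrelevant.
  refine le_antisymm (le_iInf fun k => iInf_le_of_le (k + 1) le_rfl) (le_iInf fun k => ?_)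
  exact iInf_le_of_le k (H.finiteValue_antitone θ₀ θ₁ p c a b w k.le_succ)

/-! ### The stopping set and its threshold -/

/-- The posterior probabilities `δ` for which stopping at the state `w` is optimal. -/
def stoppingSet (w : State d) : Set ℝ :=
  {t | 0 ≤ t ∧ t ≤ 1 ∧ H.value θ₀ θ₁ p c (ENNReal.ofReal t) (ENNReal.ofReal (1 - t)) w =
    ENNReal.ofReal (1 - t)}

/-- The optimal threshold for the posterior probability. -/
def threshold (w : State d) : ℝ := sInf (H.stoppingSet θ₀ θ₁ p c w)

lemma one_mem_stoppingSet (w : State d) : 1 ∈ H.stoppingSet θ₀ θ₁ p c w := by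
  refine ⟨zero_le_one, le_rfl, le_antisymm (H.value_le θ₀ θ₁ p c _ _ w) ?_⟩
  simp

lemma bddBelow_stoppingSet (w : State d) : BddBelow (H.stoppingSet θ₀ θ₁ p c w) :=
  ⟨0, fun _ ht => ht.1⟩

/-- Scaling the pair `(s, 1 - s)` by `(1 - t) / (1 - s) ≤ 1` keeps stopping optimal and makes the
second mass `1 - t`. The first mass becomes at most `s ≤ t`, and raising it to `t` can only raise
the value, which never exceeds `1 - t`. -/
lemma mem_stoppingSet_of_le {w : State d} {s t : ℝ} (hs : s ∈ H.stoppingSet θ₀ θ₁ p c w)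
    (hst : s ≤ t) (ht : t ≤ 1) : t ∈ H.stoppingSet θ₀ θ₁ p c w := by
  obtain rfl | ht1 := ht.eq_or_lt
  · exact H.one_mem_stoppingSet θ₀ θ₁ p c w
  obtain ⟨h0, -, h⟩ := hs
  refine ⟨h0.trans hst, ht, le_antisymm (H.value_le θ₀ θ₁ p c _ _ w) ?_⟩
  have hpos : 0 < 1 - s := by linarith
  have hx0 : 0 ≤ (1 - t) / (1 - s) := div_nonneg (by linarith) hpos.le
  have hx1 : (1 - t) / (1 - s) ≤ 1 := (div_le_one hpos).2 (by linarith)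
  have hxs : (1 - t) / (1 - s) * (1 - s) = 1 - t := div_mul_cancel₀ _ hpos.ne'
  have hmul := H.value_mul θ₀ θ₁ p c (t := ENNReal.ofReal ((1 - t) / (1 - s)))
    ENNReal.ofReal_ne_top (ENNReal.ofReal s) (ENNReal.ofReal (1 - s)) w
  rw [h, ← ENNReal.ofReal_mul hx0, ← ENNReal.ofReal_mul hx0, hxs] at hmul
  refine hmul.ge.trans ?_
  refine H.value_mono θ₀ θ₁ p c (ENNReal.ofReal_le_ofReal ?_) le_rfl w
  nlinarith

/-- The infimum is attained because, for each horizon, moving from a nearby point of the stopping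
set to the infimum changes both sides by a multiple of the distance. The horizon is fixed before the
point is chosen, so no uniform Lipschitz constant is required. -/
lemma threshold_mem_stoppingSet (w : State d) :
    H.threshold θ₀ θ₁ p c w ∈ H.stoppingSet θ₀ θ₁ p c w := by
  set r := H.threshold θ₀ θ₁ p c w with hr
  have hne : (H.stoppingSet θ₀ θ₁ p c w).Nonempty := ⟨1, H.one_mem_stoppingSet θ₀ θ₁ p c w⟩
  have h0 : 0 ≤ r := le_csInf hne fun t ht => ht.1
  have h1 : r ≤ 1 := csInf_le (H.bddBelow_stoppingSet θ₀ θ₁ p c w)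
    (H.one_mem_stoppingSet θ₀ θ₁ p c w)
  refine ⟨h0, h1, le_antisymm (H.value_le θ₀ θ₁ p c _ _ w) (le_iInf fun k => ?_)⟩
  refine ENNReal.le_of_forall_pos_le_add fun e he _ => ?_
  -- The term `k * max c 0` is the Lipschitz constant in the changed mass, and `1` accounts for the
  -- passage from `1 - r` to `1 - t`. The maximum appears because `ENNReal.ofReal c` truncates and
  -- no sign of `c` is assumed here.
  set K : ℝ := k * max c 0 + 1 with hK
  have hKpos : 0 < K := by positivity
  obtain ⟨t, ht, htr⟩ := exists_lt_of_csInf_lt hne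
    (show sInf (H.stoppingSet θ₀ θ₁ p c w) < r + e / K by
      rw [← threshold, ← hr]; have : 0 < (e : ℝ) / K := by positivity
      linarith)
  have hrt : r ≤ t := csInf_le (H.bddBelow_stoppingSet θ₀ θ₁ p c w) ht
  have ht0 : 0 ≤ t - r := by linarith
  have hc : ENNReal.ofReal c = ENNReal.ofReal (max c 0) := by
    simp [ENNReal.ofReal_max]
  calc ENNReal.ofReal (1 - r) = ENNReal.ofReal (1 - t) + ENNReal.ofReal (t - r) := by
        rw [← ENNReal.ofReal_add (by linarith [ht.2.1]) ht0]; ring_nf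
    _ ≤ H.finiteValue θ₀ θ₁ p c k (ENNReal.ofReal r + ENNReal.ofReal (t - r))
          (ENNReal.ofReal (1 - r)) w + ENNReal.ofReal (t - r) := by
        gcongr
        rw [← ENNReal.ofReal_add h0 ht0, add_sub_cancel]
        exact ht.2.2.ge.trans ((iInf_le _ k).trans (H.finiteValue_mono θ₀ θ₁ p c k le_rfl
          (ENNReal.ofReal_le_ofReal (by linarith)) w))
    _ ≤ H.finiteValue θ₀ θ₁ p c k (ENNReal.ofReal r) (ENNReal.ofReal (1 - r)) w +
          k * ENNReal.ofReal c * ENNReal.ofReal (t - r) + ENNReal.ofReal (t - r) := by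
        gcongr
        exact H.finiteValue_add_le θ₀ θ₁ p c k _ _ _ w
    _ = H.finiteValue θ₀ θ₁ p c k (ENNReal.ofReal r) (ENNReal.ofReal (1 - r)) w +
          ENNReal.ofReal (K * (t - r)) := by
        rw [hc, add_assoc, hK, add_mul, one_mul, ENNReal.ofReal_add (by positivity) ht0,
          ENNReal.ofReal_mul (by positivity), ENNReal.ofReal_mul (by positivity),
          ENNReal.ofReal_natCast]
    _ ≤ H.finiteValue θ₀ θ₁ p c k (ENNReal.ofReal r) (ENNReal.ofReal (1 - r)) w + e := by
        gcongr
        refine ENNReal.ofReal_le_of_le_toReal ?_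
        rw [ENNReal.coe_toReal]
        have h3 : t - r < e / K := by linarith
        rw [lt_div_iff₀ hKpos] at h3
        linarith

lemma threshold_le_iff {w : State d} {t : ℝ} (h0 : 0 ≤ t) (h1 : t ≤ 1) :
    H.threshold θ₀ θ₁ p c w ≤ t ↔
      H.value θ₀ θ₁ p c (ENNReal.ofReal t) (ENNReal.ofReal (1 - t)) w =
        ENNReal.ofReal (1 - t) := by
  refine ⟨fun h => ?_, fun h => csInf_le (H.bddBelow_stoppingSet θ₀ θ₁ p c w) ⟨h0, h1, h⟩⟩
  exact (H.mem_stoppingSet_of_le θ₀ θ₁ p c (H.threshold_mem_stoppingSet θ₀ θ₁ p c w) h h1).2.2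

/-- Since the stopping set is an up-set containing its infimum, each sublevel set for `t` in `[0,
1]` is the set of states where the jointly measurable value equals the cost of stopping. -/
lemma measurable_threshold : Measurable (H.threshold θ₀ θ₁ p c) := by
  refine measurable_of_Iic fun t => ?_
  have hmem := H.threshold_mem_stoppingSet θ₀ θ₁ p c
  rcases lt_or_ge t 0 with h0 | h0
  · convert MeasurableSet.empty
    ext w
    simpa using h0.trans_le (hmem w).1
  rcases le_total t 1 with h1 | h1
  · have : H.threshold θ₀ θ₁ p c ⁻¹' Set.Iic t = {w | H.value θ₀ θ₁ p c (ENNReal.ofReal t)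
        (ENNReal.ofReal (1 - t)) w = ENNReal.ofReal (1 - t)} := by
      ext w
      exact H.threshold_le_iff θ₀ θ₁ p c h0 h1
    rw [this]
    exact measurableSet_eq_fun (H.measurable_value_comp θ₀ θ₁ p c measurable_const
      measurable_const measurable_id) measurable_const
  · convert MeasurableSet.univ
    ext w
    simpa using (hmem w).2.1.trans h1

end Model

/-! ### Histories and the observation filtration -/

/-- The histories of the induced chain up to time `n`. -/
abbrev History (d n : ℕ) : Type := Π _ : Finset.Iic n, State d

/-- The history `(W_0, …, W_n)`. -/
def history {d : ℕ} (n : ℕ) (z : Sample d) : History d n := fun i => z.2 i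

/-- The final state of a history. -/
def History.last {d n : ℕ} (h : History d n) : State d := h ⟨n, Finset.mem_Iic.2 le_rfl⟩

/-- The history `h` continued by the state `s`. -/
def History.snoc {d n : ℕ} (h : History d n) (s : State d) : History d (n + 1) :=
  fun i => if hi : i.1 ≤ n then h ⟨i.1, Finset.mem_Iic.2 hi⟩ else s

/-- The history without its final state. -/
def History.init {d n : ℕ} (h : History d (n + 1)) : History d n :=
  fun i => h ⟨i.1, Finset.mem_Iic.2 ((Finset.mem_Iic.1 i.2).trans n.le_succ)⟩

@[simp] lemma History.init_snoc {d n : ℕ} (h : History d n) (s : State d) :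
    (h.snoc s).init = h := by
  funext i
  exact dif_pos (Finset.mem_Iic.1 i.2)

@[simp] lemma History.last_snoc {d n : ℕ} (h : History d n) (s : State d) :
    (h.snoc s).last = s := dif_neg (by simp)

@[simp] lemma init_history {d : ℕ} (n : ℕ) (z : Sample d) :
    (history (n + 1) z).init = history n z := rfl

@[simp] lemma last_history {d : ℕ} (n : ℕ) (z : Sample d) : (history n z).last = W n z := rfl

@[fun_prop]
lemma measurable_history {d : ℕ} (n : ℕ) : Measurable (history (d := d) n) := by
  unfold history; fun_prop

@[fun_prop]
lemma History.measurable_last {d n : ℕ} : Measurable (History.last (d := d) (n := n)) := by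
  unfold History.last; fun_prop

@[fun_prop]
lemma History.measurable_init {d n : ℕ} : Measurable (History.init (d := d) (n := n)) := by
  unfold History.init; fun_prop

lemma History.measurable_snoc {d n : ℕ} :
    Measurable fun q : History d n × State d => q.1.snoc q.2 := by
  refine measurable_pi_lambda _ fun i => ?_
  unfold History.snoc
  by_cases hi : i.1 ≤ n
  · simp only [hi, dif_pos]; fun_prop
  · simp only [hi, dif_neg, not_false_eq_true]; fun_prop

@[fun_prop]
lemma History.measurable_snoc_comp {d n : ℕ} {α : Type*} [MeasurableSpace α]
    {h : α → History d n} {s : α → State d} (hh : Measurable h) (hs : Measurable s) :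
    Measurable fun x => (h x).snoc (s x) :=
  History.measurable_snoc.comp (hh.prodMk hs)

@[fun_prop]
lemma measurable_changePoint {d : ℕ} : Measurable (changePoint (d := d)) := measurable_fst

lemma measurableSet_changePoint_le {d : ℕ} (n : ℕ) :
    MeasurableSet {z : Sample d | changePoint z ≤ n} :=
  measurable_changePoint (measurableSet_Iic (a := n))

lemma measurableSet_lt_changePoint {d : ℕ} (n : ℕ) :
    MeasurableSet {z : Sample d | n < changePoint z} :=
  measurable_changePoint (measurableSet_Ioi (a := n))

lemma filt_eq_comap {d : ℕ} (n : ℕ) :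
    filt d n = MeasurableSpace.comap (history n) inferInstance := by
  apply le_antisymm
  · refine iSup₂_le fun j hj => ?_
    rw [← measurable_iff_comap_le]
    have : W j = (fun h : History d n => h ⟨j, Finset.mem_Iic.2 hj⟩) ∘ history n := rfl
    rw [this]
    exact (measurable_pi_apply _).comp (comap_measurable _)
  · rw [MeasurableSpace.pi, MeasurableSpace.comap_iSup]
    refine iSup_le fun i => ?_
    rw [MeasurableSpace.comap_comp]
    exact le_iSup₂_of_le (f := fun j (_ : j ≤ n) =>
      MeasurableSpace.comap (W (d := d) j) inferInstance) i.1 (Finset.mem_Iic.1 i.2) le_rfl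

/-- This is the geometric tail `P(ω > n)` of the prior. -/
lemma tsum_priorMass_ite {β p : ℝ} (hp₀ : 0 < p) (hp₁ : p ≤ 1) (hβ : β ≤ 1) (n : ℕ) :
    ∑' k, (if n < k then ENNReal.ofReal (priorMass β p k) else 0) =
      ENNReal.ofReal ((1 - β) * (1 - p) ^ n) := by
  rw [← ENNReal.summable.sum_add_tsum_nat_add' (k := n + 1),
    Finset.sum_eq_zero fun i hi => if_neg (by simp at hi; omega), zero_add]
  have h : ∀ j, (if n < j + (n + 1) then ENNReal.ofReal (priorMass β p (j + (n + 1))) else 0) =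
      ENNReal.ofReal ((1 - β) * (1 - p) ^ n) * ENNReal.ofReal p * ENNReal.ofReal (1 - p) ^ j := by
    intro j
    have h1 : 0 ≤ 1 - p := by linarith
    have h2 : 0 ≤ 1 - β := by linarith
    rw [if_pos (by omega), ← ENNReal.ofReal_pow h1, ← ENNReal.ofReal_mul (by positivity),
      ← ENNReal.ofReal_mul (by positivity)]
    congr 1
    rw [← add_assoc, priorMass]
    ring
  simp only [h]
  rw [ENNReal.tsum_mul_left, ENNReal.tsum_geometric, ← ENNReal.ofReal_one,
    ← ENNReal.ofReal_sub _ (by linarith), sub_sub_cancel, mul_assoc,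
    ENNReal.mul_inv_cancel (by simpa using hp₀) ENNReal.ofReal_ne_top, mul_one]

/-! ### Integrals of histories under the Bayesian law -/

namespace Model

variable {Θ Φ : Type*} {d : ℕ} (H : Model Θ Φ d) (θ₀ θ₁ : Θ)

/-- The integral of a function of the history up to time `n` when the change happens at `k`. -/
def pathIntegral (w : State d) (k n : ℕ) (g : History d n → ℝ≥0∞) : ℝ≥0∞ :=
  ∫⁻ x, g (fun i => x i) ∂H.pathLaw θ₀ θ₁ k w

lemma pathIntegral_eq (w : State d) (k n : ℕ) {g : History d n → ℝ≥0∞} (hg : Measurable g) :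
    H.pathIntegral θ₀ θ₁ w k n g =
      ∫⁻ h, g h ∂Kernel.partialTraj (X := fun _ => State d) (H.changeKernel θ₀ θ₁ k) 0 n
        (fun _ => w) := by
  rw [← Kernel.traj_map_frestrictLe_apply, lintegral_map hg (Preorder.measurable_frestrictLe n)]
  rfl

lemma pathIntegral_zero (w : State d) (k : ℕ) {g : History d 0 → ℝ≥0∞} (hg : Measurable g) :
    H.pathIntegral θ₀ θ₁ w k 0 g = g fun _ => w := by
  rw [H.pathIntegral_eq _ _ _ _ _ hg, Kernel.partialTraj_self, Kernel.id_apply,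
    lintegral_dirac' _ hg]

lemma measurable_lintegral_snoc (θ : Θ) {n : ℕ} {g : History d (n + 1) → ℝ≥0∞}
    (hg : Measurable g) :
    Measurable fun h : History d n => ∫⁻ s, g (h.snoc s) ∂H.stateKernel θ₀ θ₁ θ h.last :=
  Measurable.lintegral_kernel_prod_right' (κ := (H.stateKernel θ₀ θ₁ θ).comap _
    History.measurable_last) (f := fun q : History d n × State d => g (q.1.snoc q.2))
    (hg.comp History.measurable_snoc)

lemma pathIntegral_succ (w : State d) (k n : ℕ) {g : History d (n + 1) → ℝ≥0∞}
    (hg : Measurable g) :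
    H.pathIntegral θ₀ θ₁ w k (n + 1) g = H.pathIntegral θ₀ θ₁ w k n fun h =>
      ∫⁻ s, g (h.snoc s) ∂H.stateKernel θ₀ θ₁ (if k ≤ n + 1 then θ₁ else θ₀) h.last := by
  have hJ : Measurable (IicProdIoc (X := fun _ => State d) n (n + 1)) := measurable_IicProdIoc
  have hgJ : Measurable fun q => g (IicProdIoc (X := fun _ => State d) n (n + 1) q) := hg.comp hJ
  rw [H.pathIntegral_eq _ _ _ _ _ hg,
    H.pathIntegral_eq _ _ _ _ _ (H.measurable_lintegral_snoc θ₀ θ₁ _ hg),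
    Kernel.partialTraj_succ_of_le n.zero_le, Kernel.lintegral_map _ hJ _ hg,
    Kernel.lintegral_comp _ _ _ hgJ]
  refine lintegral_congr fun h => ?_
  have hgJh : Measurable fun q => g (IicProdIoc (X := fun _ => State d) n (n + 1) (h, q)) :=
    hgJ.comp measurable_prodMk_left
  rw [Kernel.lintegral_id_prod hgJ,
    Kernel.lintegral_map _ (MeasurableEquiv.piSingleton (X := fun _ => State d) n).measurable _
      hgJh]
  refine lintegral_congr fun s => ?_
  congr 1
  -- The gluing map used in the construction of the trajectory measure agrees with `History.snoc`,
  -- coordinate by coordinate.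
  funext ⟨i, hi⟩
  by_cases hin : i ≤ n
  · simp [IicProdIoc_def, History.snoc, hin]
  · obtain rfl : i = n + 1 := by rw [Finset.mem_Iic] at hi; omega
    simp [IicProdIoc_def, History.snoc, MeasurableEquiv.piSingleton]

/-- Up to time `n` every change point later than `n` produces the same law, since all steps so far
use `θ₀`. The sum over `k > n` therefore collapses to one path integral times the tail of the prior.
-/
lemma pathIntegral_congr (w : State d) {k l n : ℕ} (hk : n < k) (hl : n < l)
    {g : History d n → ℝ≥0∞} (hg : Measurable g) :
    H.pathIntegral θ₀ θ₁ w k n g = H.pathIntegral θ₀ θ₁ w l n g := by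
  induction n with
  | zero => rw [H.pathIntegral_zero _ _ _ _ hg, H.pathIntegral_zero _ _ _ _ hg]
  | succ n ih =>
    rw [H.pathIntegral_succ _ _ _ _ _ hg, H.pathIntegral_succ _ _ _ _ _ hg,
      if_neg (by omega), if_neg (by omega)]
    exact ih (by omega) (by omega) (H.measurable_lintegral_snoc θ₀ θ₁ _ hg)

lemma lintegral_bayesLaw (β p : ℝ) (w : State d) {F : Sample d → ℝ≥0∞} (hF : Measurable F) :
    ∫⁻ z, F z ∂H.bayesLaw θ₀ θ₁ β p w =
      ∑' k, ENNReal.ofReal (priorMass β p k) * ∫⁻ x, F (k, x) ∂H.pathLaw θ₀ θ₁ k w := by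
  rw [bayesLaw, lintegral_sum_measure]
  refine tsum_congr fun k => ?_
  rw [lintegral_smul_measure, lintegral_map hF (by fun_prop), smul_eq_mul]

lemma setLIntegral_changePoint (β p : ℝ) (w : State d) (q : ℕ → Prop) [DecidablePred q] (n : ℕ)
    {g : History d n → ℝ≥0∞} (hg : Measurable g) :
    ∫⁻ z in {z | q (changePoint z)}, g (history n z) ∂H.bayesLaw θ₀ θ₁ β p w =
      ∑' k, if q k then ENNReal.ofReal (priorMass β p k) * H.pathIntegral θ₀ θ₁ w k n g
        else 0 := by
  have hq : MeasurableSet {z : Sample d | q (changePoint z)} :=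
    measurable_changePoint (MeasurableSet.of_discrete (s := {k | q k}))
  rw [← lintegral_indicator hq,
    H.lintegral_bayesLaw θ₀ θ₁ β p w (Measurable.indicator (by fun_prop) hq)]
  refine tsum_congr fun k => ?_
  by_cases hk : q k
  · rw [if_pos hk]
    congr 1
    refine lintegral_congr fun x => ?_
    rw [Set.indicator_of_mem (by exact hk)]
    rfl
  · rw [if_neg hk]
    have : ∀ x : ℕ → State d, Set.indicator {z : Sample d | q (changePoint z)}
        (fun z => g (history n z)) (k, x) = 0 := fun x => Set.indicator_of_notMem (by exact hk) _
    simp [this]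

lemma setLIntegral_changePoint_le (β p : ℝ) (w : State d) (n m : ℕ)
    {g : History d m → ℝ≥0∞} (hg : Measurable g) :
    ∫⁻ z in {z | changePoint z ≤ n}, g (history m z) ∂H.bayesLaw θ₀ θ₁ β p w =
      ∑ k ∈ Finset.range (n + 1),
        ENNReal.ofReal (priorMass β p k) * H.pathIntegral θ₀ θ₁ w k m g := by
  rw [H.setLIntegral_changePoint θ₀ θ₁ β p w (fun k => k ≤ n) m hg,
    tsum_eq_sum (s := Finset.range (n + 1)) fun k hk => if_neg (by simpa using hk)]
  exact Finset.sum_congr rfl fun k hk => if_pos (by simpa [Nat.lt_succ_iff] using hk)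

lemma setLIntegral_lt_changePoint {β p : ℝ} (hp₀ : 0 < p) (hp₁ : p ≤ 1) (hβ : β ≤ 1) (w : State d) (n : ℕ)
    {g : History d n → ℝ≥0∞} (hg : Measurable g) :
    ∫⁻ z in {z | n < changePoint z}, g (history n z) ∂H.bayesLaw θ₀ θ₁ β p w =
      ENNReal.ofReal ((1 - β) * (1 - p) ^ n) * H.pathIntegral θ₀ θ₁ w (n + 1) n g := by
  rw [H.setLIntegral_changePoint θ₀ θ₁ β p w (fun k => n < k) n hg,
    ← tsum_priorMass_ite hp₀ hp₁ hβ, ← ENNReal.tsum_mul_right]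
  refine tsum_congr fun k => ?_
  split_ifs with hk
  · rw [H.pathIntegral_congr θ₀ θ₁ w hk n.lt_succ_self hg]
  · rw [zero_mul]

end Model

/-! ### One-step recursions and the posterior -/

namespace Model

variable {Θ Φ : Type*} {d : ℕ} (H : Model Θ Φ d) (θ₀ θ₁ : Θ)

/-- The change lies at or before `n + 1` if it had already happened by time `n` or happens exactly
at `n + 1`; in both cases the next state is generated with `θ₁`. The second case has prior mass `p`
times `P(ω > n)`. -/
lemma setLIntegral_changePoint_le_succ {β p : ℝ} (hp₀ : 0 < p) (hp₁ : p ≤ 1) (hβ : β ≤ 1)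
    (w : State d) (n : ℕ) {g : History d (n + 1) → ℝ≥0∞} (hg : Measurable g) :
    ∫⁻ z in {z | changePoint z ≤ n + 1}, g (history (n + 1) z) ∂H.bayesLaw θ₀ θ₁ β p w =
      ∫⁻ z in {z | changePoint z ≤ n}, (∫⁻ s, g ((history n z).snoc s)
          ∂H.stateKernel θ₀ θ₁ θ₁ (history n z).last) ∂H.bayesLaw θ₀ θ₁ β p w +
        ENNReal.ofReal p * ∫⁻ z in {z | n < changePoint z}, (∫⁻ s, g ((history n z).snoc s)
          ∂H.stateKernel θ₀ θ₁ θ₁ (history n z).last) ∂H.bayesLaw θ₀ θ₁ β p w := by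
  have hG := H.measurable_lintegral_snoc θ₀ θ₁ θ₁ hg
  rw [H.setLIntegral_changePoint_le θ₀ θ₁ β p w (n + 1) (n + 1) hg,
    H.setLIntegral_changePoint_le θ₀ θ₁ β p w n n hG,
    H.setLIntegral_lt_changePoint θ₀ θ₁ hp₀ hp₁ hβ w n hG, Finset.sum_range_succ]
  have h : ∀ k ≤ n + 1, H.pathIntegral θ₀ θ₁ w k (n + 1) g =
      H.pathIntegral θ₀ θ₁ w k n fun h => ∫⁻ s, g (h.snoc s)
        ∂H.stateKernel θ₀ θ₁ θ₁ h.last := by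
    intro k hk
    rw [H.pathIntegral_succ θ₀ θ₁ w k n hg, if_pos hk]
  rw [h (n + 1) le_rfl, ← mul_assoc, ← ENNReal.ofReal_mul hp₀.le]
  congr 1
  · refine Finset.sum_congr rfl fun k hk => ?_
    rw [h k (by simp at hk; omega)]
  · congr 2
    rw [priorMass]
    ring

lemma setLIntegral_lt_changePoint_succ {β p : ℝ} (hp₀ : 0 < p) (hp₁ : p ≤ 1) (hβ : β ≤ 1)
    (w : State d) (n : ℕ) {g : History d (n + 1) → ℝ≥0∞} (hg : Measurable g) :
    ∫⁻ z in {z | n + 1 < changePoint z}, g (history (n + 1) z) ∂H.bayesLaw θ₀ θ₁ β p w =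
      ENNReal.ofReal (1 - p) * ∫⁻ z in {z | n < changePoint z}, (∫⁻ s, g ((history n z).snoc s)
          ∂H.stateKernel θ₀ θ₁ θ₀ (history n z).last) ∂H.bayesLaw θ₀ θ₁ β p w := by
  have hG := H.measurable_lintegral_snoc θ₀ θ₁ θ₀ hg
  rw [H.setLIntegral_lt_changePoint θ₀ θ₁ hp₀ hp₁ hβ w (n + 1) hg,
    H.setLIntegral_lt_changePoint θ₀ θ₁ hp₀ hp₁ hβ w n hG, ← mul_assoc,
    ← ENNReal.ofReal_mul (by linarith), H.pathIntegral_succ θ₀ θ₁ w _ n hg, if_neg (by omega),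
    H.pathIntegral_congr θ₀ θ₁ w (k := n + 1 + 1) (l := n + 1) (by omega) (by omega) hG]
  congr 2
  ring

lemma lintegral_bayesLaw_eq_add (β p : ℝ) (w : State d) (n : ℕ) (F : Sample d → ℝ≥0∞) :
    ∫⁻ z, F z ∂H.bayesLaw θ₀ θ₁ β p w =
      ∫⁻ z in {z | changePoint z ≤ n}, F z ∂H.bayesLaw θ₀ θ₁ β p w +
        ∫⁻ z in {z | n < changePoint z}, F z ∂H.bayesLaw θ₀ θ₁ β p w := by
  rw [← lintegral_add_compl F (measurableSet_changePoint_le n)]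
  congr 3
  ext z
  simp

lemma isProbabilityMeasure_bayesLaw {β p : ℝ} (hp₀ : 0 < p) (hp₁ : p ≤ 1) (hβ₀ : 0 ≤ β)
    (hβ : β ≤ 1) (w : State d) : IsProbabilityMeasure (H.bayesLaw θ₀ θ₁ β p w) := by
  constructor
  have h := H.lintegral_bayesLaw_eq_add θ₀ θ₁ β p w 0 fun _ => 1
  rw [H.setLIntegral_changePoint_le θ₀ θ₁ β p w 0 0 (g := fun _ => 1) measurable_const,
    H.setLIntegral_lt_changePoint θ₀ θ₁ hp₀ hp₁ hβ w 0 (g := fun _ => 1) measurable_const,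
    H.pathIntegral_zero θ₀ θ₁ w 1 (g := fun _ => 1) measurable_const, zero_add,
    Finset.sum_range_one,
    H.pathIntegral_zero θ₀ θ₁ w 0 (g := fun _ => 1) measurable_const] at h
  rw [← lintegral_one, h, mul_one, mul_one, pow_zero, mul_one, priorMass,
    ← ENNReal.ofReal_add hβ₀ (by linarith)]
  simp

lemma measure_lt_changePoint {β p : ℝ} (hp₀ : 0 < p) (hp₁ : p ≤ 1) (hβ : β ≤ 1) (w : State d)
    (n : ℕ) : H.bayesLaw θ₀ θ₁ β p w {z | n < changePoint z} =
      ENNReal.ofReal ((1 - β) * (1 - p) ^ n) := by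
  have h := H.setLIntegral_lt_changePoint θ₀ θ₁ hp₀ hp₁ hβ w n (g := fun _ => 1) measurable_const
  simpa [pathIntegral] using h

/-- The conditional probabilities, given a history, that the change has and has not happened. -/
def posteriorPair (β p : ℝ) : (n : ℕ) → History d n → ℝ≥0∞ × ℝ≥0∞
  | 0 => fun _ => (ENNReal.ofReal β, ENNReal.ofReal (1 - β))
  | n + 1 => fun h =>
    let q := posteriorPair β p n h.init
    let a := H.changedMass θ₁ p q.1 q.2 h.init.last.1 h.last.1
    let b := H.unchangedMass θ₀ p q.2 h.init.last.1 h.last.1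
    (a / (a + b), b / (a + b))

@[fun_prop]
lemma measurable_posteriorPair (β p : ℝ) (n : ℕ) :
    Measurable (H.posteriorPair θ₀ θ₁ β p n) := by
  induction n with
  | zero => exact measurable_const
  | succ n ih =>
    have ih' : Measurable fun h : History d (n + 1) => H.posteriorPair θ₀ θ₁ β p n h.init :=
      ih.comp History.measurable_init
    unfold posteriorPair
    fun_prop

/-- Equality can fail: on histories of density zero the normalization is `0 / 0 = 0` and both
entries vanish. -/
lemma posteriorPair_add_le {β : ℝ} (hβ₀ : 0 ≤ β) (hβ : β ≤ 1) (p : ℝ) (n : ℕ) (h : History d n) :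
    (H.posteriorPair θ₀ θ₁ β p n h).1 + (H.posteriorPair θ₀ θ₁ β p n h).2 ≤ 1 := by
  cases n with
  | zero =>
    simp only [posteriorPair]
    rw [← ENNReal.ofReal_add hβ₀ (by linarith)]
    simp
  | succ n =>
    simp only [posteriorPair]
    rw [← ENNReal.add_div]
    exact ENNReal.div_self_le_one

variable {β p : ℝ} (w : State d)

lemma posteriorPair_fst_ne_top (hβ₀ : 0 ≤ β) (hβ : β ≤ 1) (n : ℕ) (h : History d n) :
    (H.posteriorPair θ₀ θ₁ β p n h).1 ≠ ∞ :=
  ne_top_of_le_ne_top ENNReal.one_ne_top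
    (le_self_add.trans (H.posteriorPair_add_le θ₀ θ₁ hβ₀ hβ p n h))

lemma posteriorPair_snd_ne_top (hβ₀ : 0 ≤ β) (hβ : β ≤ 1) (n : ℕ) (h : History d n) :
    (H.posteriorPair θ₀ θ₁ β p n h).2 ≠ ∞ :=
  ne_top_of_le_ne_top ENNReal.one_ne_top
    (le_add_self.trans (H.posteriorPair_add_le θ₀ θ₁ hβ₀ hβ p n h))

/-- The mass of the changed event after a history continued by the observation `y'`. -/
def nextChanged (β p : ℝ) {n : ℕ} (h : History d n) (y' : Pair d) : ℝ≥0∞ :=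
  H.changedMass θ₁ p (H.posteriorPair θ₀ θ₁ β p n h).1 (H.posteriorPair θ₀ θ₁ β p n h).2
    h.last.1 y'

/-- The mass of the unchanged event after a history continued by the observation `y'`. -/
def nextUnchanged (β p : ℝ) {n : ℕ} (h : History d n) (y' : Pair d) : ℝ≥0∞ :=
  H.unchangedMass θ₀ p (H.posteriorPair θ₀ θ₁ β p n h).2 h.last.1 y'

/-- A history continued by the step of the induced chain with the observation `y'`. -/
def extend {n : ℕ} (h : History d n) (y' : Pair d) : History d (n + 1) :=
  h.snoc (H.step θ₀ θ₁ h.last y')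

lemma measurable_extend {n : ℕ} :
    Measurable fun q : History d n × Pair d => H.extend θ₀ θ₁ q.1 q.2 := by
  unfold extend
  fun_prop

lemma measurable_nextChanged {n : ℕ} :
    Measurable fun q : History d n × Pair d => H.nextChanged θ₀ θ₁ β p q.1 q.2 := by
  unfold nextChanged
  fun_prop

lemma posteriorPair_extend {n : ℕ} (h : History d n) (y' : Pair d) :
    H.posteriorPair θ₀ θ₁ β p (n + 1) (H.extend θ₀ θ₁ h y') =
      (H.nextChanged θ₀ θ₁ β p h y' /
          (H.nextChanged θ₀ θ₁ β p h y' + H.nextUnchanged θ₀ θ₁ β p h y'),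
        H.nextUnchanged θ₀ θ₁ β p h y' /
          (H.nextChanged θ₀ θ₁ β p h y' + H.nextUnchanged θ₀ θ₁ β p h y')) := by
  simp only [posteriorPair, extend, History.init_snoc, History.last_snoc]
  rfl

lemma next_add_ne_top (hβ₀ : 0 ≤ β) (hβ : β ≤ 1) {n : ℕ} (h : History d n) (y' : Pair d) :
    H.nextChanged θ₀ θ₁ β p h y' + H.nextUnchanged θ₀ θ₁ β p h y' ≠ ∞ := by
  have h1 := H.posteriorPair_fst_ne_top θ₀ θ₁ (p := p) hβ₀ hβ n h
  have h2 := H.posteriorPair_snd_ne_top θ₀ θ₁ (p := p) hβ₀ hβ n h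
  unfold nextChanged nextUnchanged changedMass unchangedMass density
  finiteness

/-- Undoing the normalization is valid without exception: if the total mass is zero, so are both
summands. -/
lemma next_add_mul_posteriorPair_extend (hβ₀ : 0 ≤ β) (hβ : β ≤ 1) {n : ℕ} (h : History d n)
    (y' : Pair d) :
    (H.nextChanged θ₀ θ₁ β p h y' + H.nextUnchanged θ₀ θ₁ β p h y') *
        (H.posteriorPair θ₀ θ₁ β p (n + 1) (H.extend θ₀ θ₁ h y')).1 =
          H.nextChanged θ₀ θ₁ β p h y' ∧
      (H.nextChanged θ₀ θ₁ β p h y' + H.nextUnchanged θ₀ θ₁ β p h y') *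
        (H.posteriorPair θ₀ θ₁ β p (n + 1) (H.extend θ₀ θ₁ h y')).2 =
          H.nextUnchanged θ₀ θ₁ β p h y' := by
  have htop := H.next_add_ne_top θ₀ θ₁ (p := p) hβ₀ hβ h y'
  rw [H.posteriorPair_extend]
  constructor
  · exact ENNReal.mul_div_cancel' (fun h0 => (add_eq_zero.1 h0).1) (fun h0 => absurd h0 htop)
  · exact ENNReal.mul_div_cancel' (fun h0 => (add_eq_zero.1 h0).2) (fun h0 => absurd h0 htop)

lemma lintegral_snoc_stateKernel (θ : Θ) {n : ℕ} {g : History d (n + 1) → ℝ≥0∞}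
    (hg : Measurable g) (h : History d n) :
    ∫⁻ s, g (h.snoc s) ∂H.stateKernel θ₀ θ₁ θ h.last =
      ∫⁻ y', H.density θ h.last.1 y' * g (H.extend θ₀ θ₁ h y') ∂H.refMeasure :=
  H.lintegral_stateKernel θ₀ θ₁ θ h.last (g := fun s => g (h.snoc s)) (by fun_prop)

/-- The joint law of the history and the event of a change is given by the posterior pair. -/
def HasPosterior (P : Measure (Sample d)) (n : ℕ) (q : History d n → ℝ≥0∞ × ℝ≥0∞) : Prop :=
  ∀ g : History d n → ℝ≥0∞, Measurable g →
    ∫⁻ z in {z | changePoint z ≤ n}, g (history n z) ∂P =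
        ∫⁻ z, (q (history n z)).1 * g (history n z) ∂P ∧
      ∫⁻ z in {z | n < changePoint z}, g (history n z) ∂P =
        ∫⁻ z, (q (history n z)).2 * g (history n z) ∂P

lemma setLIntegral_succ_of_hasPosterior (hp₀ : 0 < p) (hp₁ : p ≤ 1) (hβ : β ≤ 1) {n : ℕ}
    (hq : HasPosterior (H.bayesLaw θ₀ θ₁ β p w) n (H.posteriorPair θ₀ θ₁ β p n))
    {g : History d (n + 1) → ℝ≥0∞} (hg : Measurable g) :
    ∫⁻ z in {z | changePoint z ≤ n + 1}, g (history (n + 1) z) ∂H.bayesLaw θ₀ θ₁ β p w =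
        ∫⁻ z, ∫⁻ y', H.nextChanged θ₀ θ₁ β p (history n z) y' *
          g (H.extend θ₀ θ₁ (history n z) y') ∂H.refMeasure ∂H.bayesLaw θ₀ θ₁ β p w ∧
      ∫⁻ z in {z | n + 1 < changePoint z}, g (history (n + 1) z) ∂H.bayesLaw θ₀ θ₁ β p w =
        ∫⁻ z, ∫⁻ y', H.nextUnchanged θ₀ θ₁ β p (history n z) y' *
          g (H.extend θ₀ θ₁ (history n z) y') ∂H.refMeasure ∂H.bayesLaw θ₀ θ₁ β p w := by
  have hm : ∀ (θ : Θ) (h : History d n),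
      Measurable fun y' => H.density θ h.last.1 y' * g (H.extend θ₀ θ₁ h y') := fun θ h =>
    (H.measurable_density_comp θ measurable_const measurable_id).mul
      (hg.comp ((H.measurable_extend θ₀ θ₁).comp measurable_prodMk_left))
  have hG₁ := H.measurable_lintegral_snoc θ₀ θ₁ θ₁ hg
  have hG₁' : Measurable fun z => ∫⁻ s, g ((history n z).snoc s)
      ∂H.stateKernel θ₀ θ₁ θ₁ (history n z).last := hG₁.comp (measurable_history n)
  have hG₀ := H.measurable_lintegral_snoc θ₀ θ₁ θ₀ hg
  have hG₀' : Measurable fun z => ∫⁻ s, g ((history n z).snoc s)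
      ∂H.stateKernel θ₀ θ₁ θ₀ (history n z).last := hG₀.comp (measurable_history n)
  constructor
  · rw [H.setLIntegral_changePoint_le_succ θ₀ θ₁ hp₀ hp₁ hβ w n hg, (hq _ hG₁).1, (hq _ hG₁).2,
      ← lintegral_const_mul _ (by fun_prop), ← lintegral_add_left (by fun_prop)]
    refine lintegral_congr fun z => ?_
    rw [H.lintegral_snoc_stateKernel θ₀ θ₁ θ₁ hg, ← mul_assoc, ← add_mul,
      ← lintegral_const_mul _ (hm _ _)]
    simp only [nextChanged, changedMass, mul_assoc]
  · rw [H.setLIntegral_lt_changePoint_succ θ₀ θ₁ hp₀ hp₁ hβ w n hg, (hq _ hG₀).2,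
      ← lintegral_const_mul _ (by fun_prop)]
    refine lintegral_congr fun z => ?_
    rw [H.lintegral_snoc_stateKernel θ₀ θ₁ θ₀ hg, ← mul_assoc,
      ← lintegral_const_mul _ (hm _ _)]
    simp only [nextUnchanged, unchangedMass, mul_assoc]

lemma lintegral_succ_of_hasPosterior (hp₀ : 0 < p) (hp₁ : p ≤ 1) (hβ : β ≤ 1) {n : ℕ}
    (hq : HasPosterior (H.bayesLaw θ₀ θ₁ β p w) n (H.posteriorPair θ₀ θ₁ β p n))
    {g : History d (n + 1) → ℝ≥0∞} (hg : Measurable g) :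
    ∫⁻ z, g (history (n + 1) z) ∂H.bayesLaw θ₀ θ₁ β p w =
      ∫⁻ z, ∫⁻ y', (H.nextChanged θ₀ θ₁ β p (history n z) y' +
        H.nextUnchanged θ₀ θ₁ β p (history n z) y') *
          g (H.extend θ₀ θ₁ (history n z) y') ∂H.refMeasure ∂H.bayesLaw θ₀ θ₁ β p w := by
  have hF : Measurable fun q : Sample d × Pair d =>
      H.nextChanged θ₀ θ₁ β p (history n q.1) q.2 * g (H.extend θ₀ θ₁ (history n q.1) q.2) :=
    ((H.measurable_nextChanged θ₀ θ₁).mul (hg.comp (H.measurable_extend θ₀ θ₁))).comp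
      (f := fun q : Sample d × Pair d => (history n q.1, q.2)) (by fun_prop)
  rw [H.lintegral_bayesLaw_eq_add θ₀ θ₁ β p w (n + 1),
    (H.setLIntegral_succ_of_hasPosterior θ₀ θ₁ w hp₀ hp₁ hβ hq hg).1,
    (H.setLIntegral_succ_of_hasPosterior θ₀ θ₁ w hp₀ hp₁ hβ hq hg).2,
    ← lintegral_add_left hF.lintegral_prod_right']
  refine lintegral_congr fun z => ?_
  refine (lintegral_add_left (hF.comp measurable_prodMk_left) _).symm.trans ?_
  exact lintegral_congr fun y' => (add_mul _ _ _).symm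

/-- Bayes' formula, by induction. The density of the next observation given the history is the sum
of the two new masses, and it cancels the denominator of the updated pair. -/
lemma hasPosterior (hp₀ : 0 < p) (hp₁ : p ≤ 1) (hβ₀ : 0 ≤ β) (hβ : β ≤ 1) (n : ℕ) :
    HasPosterior (H.bayesLaw θ₀ θ₁ β p w) n (H.posteriorPair θ₀ θ₁ β p n) := by
  induction n with
  | zero =>
    intro g hg
    have h1 := H.setLIntegral_changePoint_le θ₀ θ₁ β p w 0 0 hg
    have h2 := H.setLIntegral_lt_changePoint θ₀ θ₁ hp₀ hp₁ hβ w 0 hg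
    rw [H.pathIntegral_zero θ₀ θ₁ w _ hg] at h2
    rw [zero_add, Finset.sum_range_one, H.pathIntegral_zero θ₀ θ₁ w _ hg] at h1
    simp only [pow_zero, mul_one, priorMass] at h1 h2
    have h3 : ∫⁻ z, g (history 0 z) ∂H.bayesLaw θ₀ θ₁ β p w = g fun _ => w := by
      rw [H.lintegral_bayesLaw_eq_add θ₀ θ₁ β p w 0, h1, h2, ← add_mul,
        ← ENNReal.ofReal_add hβ₀ (by linarith)]
      simp
    simp only [posteriorPair]
    rw [h1, h2, lintegral_const_mul _ (by fun_prop), lintegral_const_mul _ (by fun_prop), h3]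
    exact ⟨rfl, rfl⟩
  | succ n ih =>
    intro g hg
    rw [(H.setLIntegral_succ_of_hasPosterior θ₀ θ₁ w hp₀ hp₁ hβ ih hg).1,
      (H.setLIntegral_succ_of_hasPosterior θ₀ θ₁ w hp₀ hp₁ hβ ih hg).2,
      H.lintegral_succ_of_hasPosterior θ₀ θ₁ w hp₀ hp₁ hβ ih
        (g := fun h => (H.posteriorPair θ₀ θ₁ β p (n + 1) h).1 * g h) (by fun_prop),
      H.lintegral_succ_of_hasPosterior θ₀ θ₁ w hp₀ hp₁ hβ ih
        (g := fun h => (H.posteriorPair θ₀ θ₁ β p (n + 1) h).2 * g h) (by fun_prop)]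
    simp only [← mul_assoc, H.next_add_mul_posteriorPair_extend θ₀ θ₁ hβ₀ hβ, and_self]

lemma exists_measurableSet_history {n : ℕ} {S : Set (Sample d)} (hS : MeasurableSet[filt d n] S) :
    ∃ T : Set (History d n), MeasurableSet T ∧ history n ⁻¹' T = S := by
  rw [filt_eq_comap] at hS
  exact hS

lemma setLIntegral_posteriorPair (hp₀ : 0 < p) (hp₁ : p ≤ 1) (hβ₀ : 0 ≤ β) (hβ : β ≤ 1) {n : ℕ}
    {S : Set (Sample d)} (hS : MeasurableSet[filt d n] S) :
    ∫⁻ z in S, (H.posteriorPair θ₀ θ₁ β p n (history n z)).1 ∂H.bayesLaw θ₀ θ₁ β p w =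
        H.bayesLaw θ₀ θ₁ β p w (S ∩ {z | changePoint z ≤ n}) ∧
      ∫⁻ z in S, (H.posteriorPair θ₀ θ₁ β p n (history n z)).2 ∂H.bayesLaw θ₀ θ₁ β p w =
        H.bayesLaw θ₀ θ₁ β p w (S ∩ {z | n < changePoint z}) := by
  obtain ⟨T, hT, rfl⟩ := exists_measurableSet_history hS
  have hT' := measurable_history n hT
  have hind : ∀ z, T.indicator (fun _ => (1 : ℝ≥0∞)) (history n z) =
      (history n ⁻¹' T).indicator (fun _ => 1) z := fun z => rfl
  have hmul : ∀ (a : ℝ≥0∞) z, a * (history n ⁻¹' T).indicator (fun _ => 1) z =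
      (history n ⁻¹' T).indicator (fun _ => a) z := by
    intro a z
    by_cases hz : z ∈ history n ⁻¹' T <;> simp [hz]
  obtain ⟨h1, h2⟩ := H.hasPosterior θ₀ θ₁ w hp₀ hp₁ hβ₀ hβ n (T.indicator fun _ => 1)
    (measurable_const.indicator hT)
  simp only [hind, hmul] at h1 h2
  rw [lintegral_indicator hT', lintegral_const, one_mul, Measure.restrict_restrict hT',
    Measure.restrict_apply_univ] at h1 h2
  rw [h1, h2, ← lintegral_indicator hT', ← lintegral_indicator hT']
  exact ⟨rfl, rfl⟩

/-- The weight of the next observation is the normalizing constant of the new posterior, so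
homogeneity of the value absorbs it. The integral that remains is the one in `continuationRisk`. -/
lemma setLIntegral_value_succ (c : ℝ) (hp₀ : 0 < p) (hp₁ : p ≤ 1) (hβ₀ : 0 ≤ β) (hβ : β ≤ 1)
    {n : ℕ} {S : Set (Sample d)} (hS : MeasurableSet[filt d n] S) :
    ∫⁻ z in S, H.value θ₀ θ₁ p c (H.posteriorPair θ₀ θ₁ β p (n + 1) (history (n + 1) z)).1
        (H.posteriorPair θ₀ θ₁ β p (n + 1) (history (n + 1) z)).2 (W (n + 1) z)
        ∂H.bayesLaw θ₀ θ₁ β p w =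
      ∫⁻ z in S, ∫⁻ y', H.value θ₀ θ₁ p c (H.nextChanged θ₀ θ₁ β p (history n z) y')
        (H.nextUnchanged θ₀ θ₁ β p (history n z) y') (H.step θ₀ θ₁ (W n z) y') ∂H.refMeasure
        ∂H.bayesLaw θ₀ θ₁ β p w := by
  obtain ⟨T, hT, rfl⟩ := exists_measurableSet_history hS
  have hT' := measurable_history n hT
  have hmeas : Measurable fun h : History d (n + 1) => H.value θ₀ θ₁ p c
      (H.posteriorPair θ₀ θ₁ β p (n + 1) h).1 (H.posteriorPair θ₀ θ₁ β p (n + 1) h).2 h.last :=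
    H.measurable_value_comp θ₀ θ₁ p c (by fun_prop) (by fun_prop) (by fun_prop)
  have key := H.lintegral_succ_of_hasPosterior θ₀ θ₁ w hp₀ hp₁ hβ
    (H.hasPosterior θ₀ θ₁ w hp₀ hp₁ hβ₀ hβ n)
    (hmeas.indicator (History.measurable_init hT))
  rw [← lintegral_indicator hT', ← lintegral_indicator hT']
  refine Eq.trans (lintegral_congr fun z => ?_) (key.trans (lintegral_congr fun z => ?_))
  · rfl
  · by_cases hz : history n z ∈ T
    · rw [Set.indicator_of_mem (s := history n ⁻¹' T) hz]
      refine lintegral_congr fun y' => ?_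
      obtain ⟨h1, h2⟩ := H.next_add_mul_posteriorPair_extend θ₀ θ₁ (p := p) hβ₀ hβ (history n z) y'
      rw [Set.indicator_of_mem (by simpa [extend] using hz),
        ← H.value_mul θ₀ θ₁ p c (H.next_add_ne_top θ₀ θ₁ hβ₀ hβ _ _), h1, h2]
      simp [extend]
    · rw [Set.indicator_of_notMem (s := history n ⁻¹' T) hz]
      refine (lintegral_congr fun y' => ?_).trans lintegral_zero
      rw [Set.indicator_of_notMem (by simpa [extend] using hz), mul_zero]

lemma posteriorPair_add_eq_one_ae (hp₀ : 0 < p) (hp₁ : p ≤ 1) (hβ₀ : 0 ≤ β) (hβ : β ≤ 1) (n : ℕ) :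
    ∀ᵐ z ∂H.bayesLaw θ₀ θ₁ β p w, (H.posteriorPair θ₀ θ₁ β p n (history n z)).1 +
      (H.posteriorPair θ₀ θ₁ β p n (history n z)).2 = 1 := by
  have := H.isProbabilityMeasure_bayesLaw θ₀ θ₁ hp₀ hp₁ hβ₀ hβ w
  have hle : ∀ z, (H.posteriorPair θ₀ θ₁ β p n (history n z)).1 +
      (H.posteriorPair θ₀ θ₁ β p n (history n z)).2 ≤ 1 :=
    fun z => H.posteriorPair_add_le θ₀ θ₁ hβ₀ hβ p n (history n z)
  have hint : ∫⁻ z, ((H.posteriorPair θ₀ θ₁ β p n (history n z)).1 +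
      (H.posteriorPair θ₀ θ₁ β p n (history n z)).2) ∂H.bayesLaw θ₀ θ₁ β p w = 1 := by
    obtain ⟨h1, h2⟩ := H.hasPosterior θ₀ θ₁ w hp₀ hp₁ hβ₀ hβ n (fun _ => 1) measurable_const
    simp only [mul_one] at h1 h2
    rw [lintegral_add_left (by fun_prop), ← h1, ← h2, ← H.lintegral_bayesLaw_eq_add]
    simp
  -- A function bounded by one whose integral against a probability measure is one equals one almost
  -- everywhere.
  refine ae_eq_of_ae_le_of_lintegral_le (ae_of_all _ hle) (by simp [hint]) (by fun_prop) ?_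
  simp [hint]

/-- The recursive first component depends only on the history and has the right integral over every
event of the filtration, which characterizes the conditional expectation. -/
lemma posterior_ae_eq (hp₀ : 0 < p) (hp₁ : p ≤ 1) (hβ₀ : 0 ≤ β) (hβ : β ≤ 1) (n : ℕ) :
    posterior (H.bayesLaw θ₀ θ₁ β p w) n =ᵐ[H.bayesLaw θ₀ θ₁ β p w]
      fun z => (H.posteriorPair θ₀ θ₁ β p n (history n z)).1.toReal := by
  have := H.isProbabilityMeasure_bayesLaw θ₀ θ₁ hp₀ hp₁ hβ₀ hβ w
  have hm : Measurable fun z : Sample d => (H.posteriorPair θ₀ θ₁ β p n (history n z)).1 := by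
    fun_prop
  have hint : Integrable (fun z => (H.posteriorPair θ₀ θ₁ β p n (history n z)).1.toReal)
      (H.bayesLaw θ₀ θ₁ β p w) := by
    refine integrable_toReal_of_lintegral_ne_top hm.aemeasurable ?_
    have h := (H.setLIntegral_posteriorPair θ₀ θ₁ w hp₀ hp₁ hβ₀ hβ (n := n) .univ).1
    rw [Measure.restrict_univ] at h
    rw [h]
    exact measure_ne_top _ _
  refine (ae_eq_condExp_of_forall_setIntegral_eq ((filt d).le n)
    ((integrable_const (1 : ℝ)).indicator (measurableSet_changePoint_le n))
    (fun _ _ _ => hint.integrableOn) (fun S hS _ => ?_) ?_).symm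
  · rw [integral_toReal hm.aemeasurable (ae_of_all _ fun z => lt_top_iff_ne_top.2
      (H.posteriorPair_fst_ne_top θ₀ θ₁ hβ₀ hβ n _)),
      (H.setLIntegral_posteriorPair θ₀ θ₁ w hp₀ hp₁ hβ₀ hβ hS).1,
      integral_indicator (measurableSet_changePoint_le n),
      Measure.restrict_restrict (measurableSet_changePoint_le n), Set.inter_comm]
    simp [Measure.real]
  · have h1 : Measurable[filt d n] (history (d := d) n) := by
      rw [filt_eq_comap]
      exact comap_measurable _
    have h2 : Measurable fun h => (H.posteriorPair θ₀ θ₁ β p n h).1.toReal := by fun_prop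
    exact (h2.comp h1).stronglyMeasurable.aestronglyMeasurable

end Model

/-! ### The risk as a sum over times -/

lemma delay_eq_tsum (k : ℕ) (N : WithTop ℕ) :
    delay k N = ∑' j : ℕ, if (j : WithTop ℕ) < N ∧ k ≤ j then (1 : ℝ≥0∞) else 0 := by
  induction N using WithTop.recTopCoe with
  | top =>
    refine (ENNReal.eq_top_of_forall_nnreal_le fun r => ?_).symm
    obtain ⟨m, hm⟩ := exists_nat_gt r
    calc (r : ℝ≥0∞) ≤ (m : ℝ≥0∞) := by exact_mod_cast hm.le
      _ = ∑ j ∈ Finset.Ico k (k + m), if (j : WithTop ℕ) < ⊤ ∧ k ≤ j then (1 : ℝ≥0∞) else 0 := by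
        rw [Finset.sum_congr rfl fun j hj => if_pos ⟨WithTop.coe_lt_top j, (Finset.mem_Ico.1 hj).1⟩]
        simp
      _ ≤ _ := ENNReal.sum_le_tsum _
  | coe n =>
    rw [tsum_eq_sum (s := Finset.Ico k n) fun j hj => if_neg fun h => hj
      (Finset.mem_Ico.2 ⟨h.2, WithTop.coe_lt_coe.1 h.1⟩),
      Finset.sum_congr rfl fun j hj => if_pos ⟨WithTop.coe_lt_coe.2 (Finset.mem_Ico.1 hj).2,
        (Finset.mem_Ico.1 hj).1⟩]
    rw [Finset.sum_const, Nat.card_Ico, nsmul_one]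
    rfl

lemma measurableSet_natCast_lt {d : ℕ} {N : Sample d → WithTop ℕ}
    (hN : IsStoppingTime (filt d) N) (n : ℕ) :
    MeasurableSet[filt d n] {z | (n : WithTop ℕ) < N z} := hN.measurableSet_gt n

lemma measurableSet_eq_natCast {d : ℕ} {N : Sample d → WithTop ℕ}
    (hN : IsStoppingTime (filt d) N) (n : ℕ) :
    MeasurableSet[filt d n] {z | N z = (n : WithTop ℕ)} := hN.measurableSet_eq n

/-- The contribution of time `n` to the risk of a policy. -/
def stageRisk {d : ℕ} (P : Measure (Sample d)) (c : ℝ) (N : Sample d → WithTop ℕ) (n : ℕ) : ℝ≥0∞ :=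
  P ({z | N z = n} ∩ {z | n < changePoint z}) +
    ENNReal.ofReal c * P ({z | n < N z} ∩ {z | changePoint z ≤ n})

/-- The risk of a stopping time as a sum of the contributions of the single times. -/
lemma risk_eq_tsum {d : ℕ} (P : Measure (Sample d)) (c : ℝ) {N : Sample d → WithTop ℕ}
    (hN : IsStoppingTime (filt d) N) :
    risk P c N = ∑' n, stageRisk P c N n := by
  have hlt : ∀ n : ℕ, MeasurableSet {z | (n : WithTop ℕ) < N z} := fun n =>
    (filt d).le n _ (measurableSet_natCast_lt hN n)
  have heq : ∀ n : ℕ, MeasurableSet {z | N z = (n : WithTop ℕ)} := fun n =>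
    (filt d).le n _ (measurableSet_eq_natCast hN n)
  simp only [stageRisk]
  rw [ENNReal.tsum_add, ENNReal.tsum_mul_left, risk]
  congr 1
  · rw [← measure_iUnion _ fun n => (heq n).inter (measurableSet_lt_changePoint n)]
    · congr 1
      ext z
      simp only [Set.mem_ofPred_eq, Set.mem_iUnion, Set.mem_inter_iff]
      constructor
      · intro h
        obtain ⟨n, hn⟩ := WithTop.ne_top_iff_exists.1 h.ne_top
        refine ⟨n, hn.symm, ?_⟩
        rw [← hn] at h
        exact WithTop.coe_lt_coe.1 h
      · rintro ⟨n, hn, h⟩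
        rw [hn]
        exact_mod_cast h
    · intro m n hmn
      refine Set.disjoint_left.2 fun z hm hn => hmn ?_
      have h : (m : WithTop ℕ) = n := hm.1.symm.trans hn.1
      exact_mod_cast h
  · congr 1
    have hset : ∀ n : ℕ, MeasurableSet ({z | (n : WithTop ℕ) < N z} ∩ {z | changePoint z ≤ n}) :=
      fun n => (hlt n).inter (measurableSet_changePoint_le n)
    have h : ∀ z, delay (changePoint z) (N z) = ∑' n : ℕ,
        ({z | (n : WithTop ℕ) < N z} ∩ {z | changePoint z ≤ n}).indicator 1 z := by
      intro z
      rw [delay_eq_tsum]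
      refine tsum_congr fun n => ?_
      simp only [Set.indicator_apply, Set.mem_inter_iff, Set.mem_ofPred_eq, Pi.one_apply]
    simp only [h]
    rw [lintegral_tsum fun n => (measurable_one.indicator (hset n)).aemeasurable]
    exact tsum_congr fun n => lintegral_indicator_one (hset n)

/-- A stopping time with finite risk is finite almost surely. -/
lemma ae_ne_top_of_risk_ne_top {d : ℕ} {P : Measure (Sample d)} {c : ℝ} (hc : 0 < c)
    {N : Sample d → WithTop ℕ} (hN : IsStoppingTime (filt d) N) (h : risk P c N ≠ ∞) :
    ∀ᵐ z ∂P, N z ≠ ⊤ := by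
  have hmeas : MeasurableSet {z | N z = ⊤} := by
    have : {z | N z = ⊤} = ⋂ n : ℕ, {z | (n : WithTop ℕ) < N z} := by
      ext z
      simp only [Set.mem_ofPred_eq, Set.mem_iInter]
      refine ⟨fun hz n => hz ▸ WithTop.coe_lt_top n, fun hz => ?_⟩
      by_contra hne
      obtain ⟨n, hn⟩ := WithTop.ne_top_iff_exists.1 hne
      exact (hz n).ne hn
    rw [this]
    exact MeasurableSet.iInter fun n => (filt d).le n _ (measurableSet_natCast_lt hN n)
  have hint : ∫⁻ z, delay (changePoint z) (N z) ∂P ≠ ∞ := fun htop => by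
    rw [risk, htop, ENNReal.mul_top (by simpa using hc), add_top] at h
    exact h rfl
  -- The delay is infinite wherever the policy never stops, so positive mass there would make the
  -- expected delay infinite.
  have hle : ∞ * P {z | N z = ⊤} ≤ ∫⁻ z, delay (changePoint z) (N z) ∂P := by
    rw [← setLIntegral_const]
    refine (setLIntegral_mono' hmeas fun z hz => ?_).trans (setLIntegral_le_lintegral _ _)
    rw [show N z = ⊤ from hz]
    exact le_rfl
  rw [ae_iff]
  simp only [ne_eq, not_not]
  by_contra h0
  rw [ENNReal.top_mul h0] at hle
  exact hint (top_le_iff.1 hle)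

/-! ### Optimality of the threshold time -/

namespace Model

variable {Θ Φ : Type*} {d : ℕ} (H : Model Θ Φ d) (θ₀ θ₁ : Θ)

/-- The least conditional risk at time `n`, for the problem continued from the current state. -/
def currentValue (β p c : ℝ) (n : ℕ) (z : Sample d) : ℝ≥0∞ :=
  H.value θ₀ θ₁ p c (H.posteriorPair θ₀ θ₁ β p n (history n z)).1
    (H.posteriorPair θ₀ θ₁ β p n (history n z)).2 (W n z)

/-- The conditional risk of continuing at time `n`. -/
def currentContinuation (β p c : ℝ) (n : ℕ) (z : Sample d) : ℝ≥0∞ :=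
  H.continuationRisk θ₀ θ₁ p c (H.value θ₀ θ₁ p c) (H.posteriorPair θ₀ θ₁ β p n (history n z)).1
    (H.posteriorPair θ₀ θ₁ β p n (history n z)).2 (W n z)

variable {β p c : ℝ} (w : State d)

lemma setLIntegral_currentContinuation (hp₀ : 0 < p) (hp₁ : p ≤ 1) (hβ₀ : 0 ≤ β) (hβ : β ≤ 1)
    {n : ℕ} {S : Set (Sample d)} (hS : MeasurableSet[filt d n] S) :
    ∫⁻ z in S, H.currentContinuation θ₀ θ₁ β p c n z ∂H.bayesLaw θ₀ θ₁ β p w =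
      ENNReal.ofReal c * H.bayesLaw θ₀ θ₁ β p w (S ∩ {z | changePoint z ≤ n}) +
        ∫⁻ z in S, H.currentValue θ₀ θ₁ β p c (n + 1) z ∂H.bayesLaw θ₀ θ₁ β p w := by
  rw [← (H.setLIntegral_posteriorPair θ₀ θ₁ w hp₀ hp₁ hβ₀ hβ hS).1]
  unfold currentValue
  rw [H.setLIntegral_value_succ θ₀ θ₁ w c hp₀ hp₁ hβ₀ hβ hS,
    ← lintegral_const_mul _ (by fun_prop), ← lintegral_add_left (by fun_prop)]
  rfl

lemma currentValue_eq (hβ₀ : 0 ≤ β) (hβ : β ≤ 1) (n : ℕ) (z : Sample d) :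
    H.currentValue θ₀ θ₁ β p c n z =
      min (H.posteriorPair θ₀ θ₁ β p n (history n z)).2
        (H.currentContinuation θ₀ θ₁ β p c n z) :=
  H.value_eq θ₀ θ₁ p c (H.posteriorPair_snd_ne_top θ₀ θ₁ hβ₀ hβ n _) _

lemma setLIntegral_le_split {N : Sample d → WithTop ℕ} (hN : IsStoppingTime (filt d) N) (n : ℕ)
    (P : Measure (Sample d)) (F : Sample d → ℝ≥0∞) :
    ∫⁻ z in {z | (n : WithTop ℕ) ≤ N z}, F z ∂P =
      ∫⁻ z in {z | N z = (n : WithTop ℕ)}, F z ∂P +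
        ∫⁻ z in {z | (n : WithTop ℕ) < N z}, F z ∂P := by
  rw [← lintegral_union ((filt d).le n _ (measurableSet_natCast_lt hN n))]
  · congr 2
    ext z
    simp only [Set.mem_ofPred_eq, Set.mem_union]
    rw [le_iff_lt_or_eq, or_comm, eq_comm]
  · exact Set.disjoint_left.2 fun z h1 h2 => h2.ne' h1

lemma setLIntegral_succ_le (P : Measure (Sample d)) (F : Sample d → ℝ≥0∞)
    (N : Sample d → WithTop ℕ) (n : ℕ) :
    ∫⁻ z in {z | ((n + 1 : ℕ) : WithTop ℕ) ≤ N z}, F z ∂P =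
      ∫⁻ z in {z | (n : WithTop ℕ) < N z}, F z ∂P := by
  congr 2
  ext z
  simp only [Set.mem_ofPred_eq]
  induction N z using WithTop.recTopCoe with
  | top => simp
  | coe m => exact WithTop.coe_le_coe.trans (Nat.succ_le_iff.trans WithTop.coe_lt_coe.symm)

/-- The events `N = n` and `n < N` are known at time `n`, so the probabilities in the stage risk can
be replaced by integrals of the posterior pair. The right-hand side is then comparable term by term
with the minimum in the optimality equation. -/
lemma stageRisk_add (hp₀ : 0 < p) (hp₁ : p ≤ 1) (hβ₀ : 0 ≤ β) (hβ : β ≤ 1)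
    {N : Sample d → WithTop ℕ} (hN : IsStoppingTime (filt d) N) (n : ℕ) :
    stageRisk (H.bayesLaw θ₀ θ₁ β p w) c N n +
        ∫⁻ z in {z | ((n + 1 : ℕ) : WithTop ℕ) ≤ N z}, H.currentValue θ₀ θ₁ β p c (n + 1) z
          ∂H.bayesLaw θ₀ θ₁ β p w =
      ∫⁻ z in {z | N z = (n : WithTop ℕ)}, (H.posteriorPair θ₀ θ₁ β p n (history n z)).2
          ∂H.bayesLaw θ₀ θ₁ β p w +
        ∫⁻ z in {z | (n : WithTop ℕ) < N z}, H.currentContinuation θ₀ θ₁ β p c n z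
          ∂H.bayesLaw θ₀ θ₁ β p w := by
  rw [setLIntegral_succ_le, H.setLIntegral_currentContinuation θ₀ θ₁ w hp₀ hp₁ hβ₀ hβ
    (measurableSet_natCast_lt hN n), (H.setLIntegral_posteriorPair θ₀ θ₁ w hp₀ hp₁ hβ₀ hβ
    (measurableSet_eq_natCast hN n)).2, stageRisk, add_assoc]

lemma setLIntegral_currentValue_le (hp₀ : 0 < p) (hp₁ : p ≤ 1) (hβ₀ : 0 ≤ β) (hβ : β ≤ 1)
    {N : Sample d → WithTop ℕ} (hN : IsStoppingTime (filt d) N) (n : ℕ) :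
    ∫⁻ z in {z | (n : WithTop ℕ) ≤ N z}, H.currentValue θ₀ θ₁ β p c n z
        ∂H.bayesLaw θ₀ θ₁ β p w ≤
      stageRisk (H.bayesLaw θ₀ θ₁ β p w) c N n +
        ∫⁻ z in {z | ((n + 1 : ℕ) : WithTop ℕ) ≤ N z}, H.currentValue θ₀ θ₁ β p c (n + 1) z
          ∂H.bayesLaw θ₀ θ₁ β p w := by
  rw [H.stageRisk_add θ₀ θ₁ w hp₀ hp₁ hβ₀ hβ hN, setLIntegral_le_split hN]
  gcongr <;> rw [H.currentValue_eq θ₀ θ₁ hβ₀ hβ]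
  · exact min_le_left _ _
  · exact min_le_right _ _

lemma lintegral_currentValue_zero_le_sum (hp₀ : 0 < p) (hp₁ : p ≤ 1) (hβ₀ : 0 ≤ β) (hβ : β ≤ 1)
    {N : Sample d → WithTop ℕ} (hN : IsStoppingTime (filt d) N) (n : ℕ) :
    ∫⁻ z, H.currentValue θ₀ θ₁ β p c 0 z ∂H.bayesLaw θ₀ θ₁ β p w ≤
      ∑ j ∈ Finset.range n, stageRisk (H.bayesLaw θ₀ θ₁ β p w) c N j +
        ∫⁻ z in {z | (n : WithTop ℕ) ≤ N z}, H.currentValue θ₀ θ₁ β p c n z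
          ∂H.bayesLaw θ₀ θ₁ β p w := by
  induction n with
  | zero => simp
  | succ n ih =>
    rw [Finset.sum_range_succ, add_assoc]
    refine ih.trans ?_
    gcongr
    exact H.setLIntegral_currentValue_le θ₀ θ₁ w hp₀ hp₁ hβ₀ hβ hN n

/-- In the telescoped inequality the remainder is at most the cost of stopping at time `n`, whose
expectation is `P(ω > n)` and tends to zero. The bound holds for all stopping times, proper or not.
-/
lemma lintegral_currentValue_zero_le_risk (hp₀ : 0 < p) (hp₁ : p ≤ 1) (hβ₀ : 0 ≤ β) (hβ : β ≤ 1)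
    {N : Sample d → WithTop ℕ} (hN : IsStoppingTime (filt d) N) :
    ∫⁻ z, H.currentValue θ₀ θ₁ β p c 0 z ∂H.bayesLaw θ₀ θ₁ β p w ≤
      risk (H.bayesLaw θ₀ θ₁ β p w) c N := by
  have hlim : Filter.Tendsto (fun n : ℕ => risk (H.bayesLaw θ₀ θ₁ β p w) c N +
      ENNReal.ofReal ((1 - β) * (1 - p) ^ n)) Filter.atTop
      (nhds (risk (H.bayesLaw θ₀ θ₁ β p w) c N + 0)) := by
    refine tendsto_const_nhds.add ?_
    rw [← ENNReal.ofReal_zero, ← mul_zero (1 - β)]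
    exact ENNReal.tendsto_ofReal (tendsto_const_nhds.mul
      (tendsto_pow_atTop_nhds_zero_of_lt_one (by linarith) (by linarith)))
  rw [add_zero] at hlim
  refine ge_of_tendsto' hlim fun n => ?_
  refine (H.lintegral_currentValue_zero_le_sum θ₀ θ₁ w hp₀ hp₁ hβ₀ hβ hN n).trans ?_
  gcongr
  · rw [risk_eq_tsum _ _ hN]
    exact ENNReal.sum_le_tsum _
  · rw [← H.measure_lt_changePoint θ₀ θ₁ hp₀ hp₁ hβ w]
    refine (setLIntegral_le_lintegral _ _).trans ?_
    refine (lintegral_mono fun z => H.value_le θ₀ θ₁ p c _ _ _).trans ?_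
    have h := (H.setLIntegral_posteriorPair θ₀ θ₁ w hp₀ hp₁ hβ₀ hβ (n := n) .univ).2
    rw [Measure.restrict_univ, Set.univ_inter] at h
    exact h.le

/-- A stopping time attains the least risk if at each time it stops only when stopping is optimal
and continues only when stopping is not optimal. -/
lemma risk_eq_lintegral_currentValue_zero (hp₀ : 0 < p) (hp₁ : p ≤ 1) (hβ₀ : 0 ≤ β) (hβ : β ≤ 1)
    {N : Sample d → WithTop ℕ} (hN : IsStoppingTime (filt d) N)
    (hopt : ∀ n : ℕ, ∀ᵐ z ∂H.bayesLaw θ₀ θ₁ β p w, N z = n →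
      H.currentValue θ₀ θ₁ β p c n z = (H.posteriorPair θ₀ θ₁ β p n (history n z)).2)
    (hcont : ∀ n : ℕ, ∀ᵐ z ∂H.bayesLaw θ₀ θ₁ β p w, n < N z →
      H.currentValue θ₀ θ₁ β p c n z ≠ (H.posteriorPair θ₀ θ₁ β p n (history n z)).2) :
    risk (H.bayesLaw θ₀ θ₁ β p w) c N =
      ∫⁻ z, H.currentValue θ₀ θ₁ β p c 0 z ∂H.bayesLaw θ₀ θ₁ β p w := by
  have hstep : ∀ n : ℕ, ∫⁻ z in {z | (n : WithTop ℕ) ≤ N z}, H.currentValue θ₀ θ₁ β p c n z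
        ∂H.bayesLaw θ₀ θ₁ β p w =
      stageRisk (H.bayesLaw θ₀ θ₁ β p w) c N n +
        ∫⁻ z in {z | ((n + 1 : ℕ) : WithTop ℕ) ≤ N z}, H.currentValue θ₀ θ₁ β p c (n + 1) z
          ∂H.bayesLaw θ₀ θ₁ β p w := by
    intro n
    rw [H.stageRisk_add θ₀ θ₁ w hp₀ hp₁ hβ₀ hβ hN, setLIntegral_le_split hN]
    congr 1
    · exact setLIntegral_congr_fun_ae ((filt d).le n _ (measurableSet_eq_natCast hN n)) (hopt n)
    · refine setLIntegral_congr_fun_ae ((filt d).le n _ (measurableSet_natCast_lt hN n)) ?_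
      filter_upwards [hcont n] with z hz hlt
      have h := hz hlt
      rw [H.currentValue_eq θ₀ θ₁ hβ₀ hβ] at h ⊢
      exact min_eq_right (le_of_not_ge fun hle => h (min_eq_left hle))
  have hsum : ∀ n : ℕ, ∑ j ∈ Finset.range n, stageRisk (H.bayesLaw θ₀ θ₁ β p w) c N j +
        ∫⁻ z in {z | (n : WithTop ℕ) ≤ N z}, H.currentValue θ₀ θ₁ β p c n z
          ∂H.bayesLaw θ₀ θ₁ β p w =
      ∫⁻ z, H.currentValue θ₀ θ₁ β p c 0 z ∂H.bayesLaw θ₀ θ₁ β p w := by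
    intro n
    induction n with
    | zero => simp
    | succ n ih => rw [Finset.sum_range_succ, add_assoc, ← hstep, ih]
  refine le_antisymm ?_ (H.lintegral_currentValue_zero_le_risk θ₀ θ₁ w hp₀ hp₁ hβ₀ hβ hN)
  -- For the upper bound the remainder in `hsum` is nonnegative and can be dropped, so no limit is
  -- taken.
  rw [risk_eq_tsum _ _ hN]
  exact ENNReal.tsum_le_of_sum_range_le fun n => le_self_add.trans (hsum n).le

lemma isStoppingTime_thresholdTime {P : Measure (Sample d)} {A : State d → ℝ} (hA : Measurable A) :
    IsStoppingTime (filt d) (thresholdTime P A) := by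
  refine Adapted.isStoppingTime_hittingAfter (fun n => ?_)
    (measurableSet_le (by fun_prop : Measurable fun x : ℝ × State d => A x.2) measurable_fst)
  have h1 : Measurable[filt d n] (posterior P n) := stronglyMeasurable_condExp.measurable
  have h2 : Measurable[filt d n] (W (d := d) n) := by
    have h3 : Measurable[filt d n] (history (d := d) n) := by
      rw [filt_eq_comap]
      exact comap_measurable _
    exact History.measurable_last.comp h3
  exact h1.prodMk h2

/-- Almost surely the posterior pair sums to one, hence has the form `(t, 1 - t)` with `t` the
posterior probability. On such pairs `threshold_le_iff` applies. -/
lemma threshold_le_posterior_iff_ae (hp₀ : 0 < p) (hp₁ : p ≤ 1) (hβ₀ : 0 ≤ β) (hβ : β ≤ 1)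
    (n : ℕ) : ∀ᵐ z ∂H.bayesLaw θ₀ θ₁ β p w,
      H.threshold θ₀ θ₁ p c (W n z) ≤ posterior (H.bayesLaw θ₀ θ₁ β p w) n z ↔
        H.currentValue θ₀ θ₁ β p c n z = (H.posteriorPair θ₀ θ₁ β p n (history n z)).2 := by
  filter_upwards [H.posterior_ae_eq θ₀ θ₁ w hp₀ hp₁ hβ₀ hβ n,
    H.posteriorPair_add_eq_one_ae θ₀ θ₁ w hp₀ hp₁ hβ₀ hβ n] with z h1 h2
  have ha := H.posteriorPair_fst_ne_top θ₀ θ₁ (p := p) hβ₀ hβ n (history n z)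
  have hle : (H.posteriorPair θ₀ θ₁ β p n (history n z)).1 ≤ 1 := h2 ▸ le_self_add
  have hb : ENNReal.ofReal (1 - (H.posteriorPair θ₀ θ₁ β p n (history n z)).1.toReal) =
      (H.posteriorPair θ₀ θ₁ β p n (history n z)).2 := by
    rw [ENNReal.ofReal_sub _ ENNReal.toReal_nonneg, ENNReal.ofReal_toReal ha, ENNReal.ofReal_one,
      ← h2, ENNReal.add_sub_cancel_left ha]
  rw [h1, H.threshold_le_iff θ₀ θ₁ p c ENNReal.toReal_nonneg
    (ENNReal.toReal_le_of_le_ofReal zero_le_one (by simpa using hle)), hb,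
    ENNReal.ofReal_toReal ha]
  rfl

lemma isBayesTime_thresholdTime (hp₀ : 0 < p) (hp₁ : p ≤ 1) (hc : 0 < c) (hβ₀ : 0 ≤ β)
    (hβ : β ≤ 1) : IsBayesTime (H.bayesLaw θ₀ θ₁ β p w) c
      (thresholdTime (H.bayesLaw θ₀ θ₁ β p w) (H.threshold θ₀ θ₁ p c)) := by
  have hprob := H.isProbabilityMeasure_bayesLaw θ₀ θ₁ hp₀ hp₁ hβ₀ hβ w
  have hN := isStoppingTime_thresholdTime (P := H.bayesLaw θ₀ θ₁ β p w)
    (H.measurable_threshold θ₀ θ₁ p c)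
  have hrisk := H.risk_eq_lintegral_currentValue_zero θ₀ θ₁ w (c := c) hp₀ hp₁ hβ₀ hβ hN
    (fun n => by
      filter_upwards [H.threshold_le_posterior_iff_ae θ₀ θ₁ w (c := c) hp₀ hp₁ hβ₀ hβ n] with z hz h
      rw [← hz]
      by_cases hex : ∃ j, 0 ≤ j ∧ (posterior (H.bayesLaw θ₀ θ₁ β p w) j z, W j z) ∈
          {x : ℝ × State d | H.threshold θ₀ θ₁ p c x.2 ≤ x.1}
      · have hmem := hittingAfter_mem_set (u := fun n z =>
          (posterior (H.bayesLaw θ₀ θ₁ β p w) n z, W n z)) hex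
        rw [thresholdTime] at h
        rw [h] at hmem
        exact hmem
      -- If the set is never hit, the hitting time is `⊤` and cannot equal `n`.
      · rw [thresholdTime, hittingAfter, if_neg hex] at h
        exact absurd h (WithTop.coe_ne_top (a := n)).symm)
    (fun n => by
      filter_upwards [H.threshold_le_posterior_iff_ae θ₀ θ₁ w (c := c) hp₀ hp₁ hβ₀ hβ n] with z hz h
      rw [ne_eq, ← hz]
      exact notMem_of_lt_hittingAfter (u := fun n z =>
        (posterior (H.bayesLaw θ₀ θ₁ β p w) n z, W n z)) h n.zero_le)
  have hfin : risk (H.bayesLaw θ₀ θ₁ β p w) c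
      (thresholdTime (H.bayesLaw θ₀ θ₁ β p w) (H.threshold θ₀ θ₁ p c)) ≠ ∞ := by
    rw [hrisk]
    refine ne_top_of_le_ne_top ENNReal.one_ne_top ?_
    -- The initial value is at most the cost of stopping at once, which is at most one.
    calc _ ≤ ∫⁻ _, 1 ∂H.bayesLaw θ₀ θ₁ β p w := lintegral_mono fun z =>
          (H.value_le θ₀ θ₁ p c _ _ _).trans
            (le_add_self.trans (H.posteriorPair_add_le θ₀ θ₁ hβ₀ hβ p 0 (history 0 z)))
      _ = 1 := by simp
  have hproper := ae_ne_top_of_risk_ne_top hc hN hfin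
  refine ⟨⟨hN, hproper⟩, le_antisymm (le_iInf₂ fun N' hN' => ?_) (iInf₂_le _ ⟨hN, hproper⟩)⟩
  rw [hrisk]
  exact H.lintegral_currentValue_zero_le_risk θ₀ θ₁ w hp₀ hp₁ hβ₀ hβ hN'.1

end Model

end HMMChange

end

theorem proposition1 {Θ Φ : Type*} {d : ℕ} (H : HMMChange.Model Θ Φ d) (θ₀ θ₁ : Θ)
    (p c : ℝ) (hp₀ : 0 < p) (hp₁ : p ≤ 1) (hc : 0 < c) :
    ∃ A : HMMChange.State d → ℝ, Measurable A ∧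
      ∀ (β : ℝ) (w : HMMChange.State d), 0 ≤ β → β ≤ 1 →
        HMMChange.IsBayesTime (H.bayesLaw θ₀ θ₁ β p w) c
          (HMMChange.thresholdTime (H.bayesLaw θ₀ θ₁ β p w) A) :=
  ⟨H.threshold θ₀ θ₁ p c, H.measurable_threshold θ₀ θ₁ p c, fun _ w hβ₀ hβ =>
    H.isBayesTime_thresholdTime θ₀ θ₁ w hp₀ hp₁ hc hβ₀ hβ⟩
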